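/- Let $V$ be a real vector space of finite dimension $n$ with its canonical topology, and let $\Delta\subset V$ be a non-empty polyhedron of dimension $n$, i.e. $\Delta$ is the set of solutions of finitely many (non-strict) affine-linear inequalities, and its affine span is $V$. Let $\Delta^\circ$ be the interior of $\Delta$ and $j:\Delta^\circ\hookrightarrow\Delta$ the inclusion. The faces $\sigma\leqslant\Delta$ are the non-empty subsets of $\Delta$ on which some linear functional on $V$ attains its extremal value over $\Delta$ (including $\sigma=\Delta$); put $c_\sigma:=n-\dim\sigma$. For a face $\sigma$ let $\mathbb Z_\sigma$ be the direct image under $\sigma\hookrightarrow\Delta$ of the constant sheaf with stalk $\mathbb Z$ on $\sigma$. Choose an orientation of each face of $\Delta$ (for a vertex: a sign). For faces $\tau\subset\sigma$ with $c_\tau=c_\sigma+1$ let $\varepsilon_{\sigma,\tau}\in\{1,-1\}$ be the incidence number: $\varepsilon_{\sigma,\tau}=1$ if and only if, for a basis $v_1,\dots,v_d$ of the direction space of $\tau$ and a vector $w=x-y$ with $x\in\sigma\setminus\tau$, $y\in\tau$, the bases $(v_1,\dots,v_d)$ of the direction of $\tau$ and $(w,v_1,\dots,v_d)$ of the direction of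 $\sigma$ are either both positively oriented or both negatively oriented. Put $$C_\Delta^p:=\bigoplus_{c_\sigma=p}\mathbb Z_\sigma\qquad(p\geqslant 0),$$ and let $d^p:C^p_\Delta\to C^{p+1}_\Delta$ be the morphism whose component $\mathbb Z_\sigma\to\mathbb Z_\tau$ is $\varepsilon_{\sigma,\tau}$ times the restriction morphism if $\tau\subset\sigma$, and $0$ otherwise. Then, for every choice of the orientations, $d^{p+1}d^p=0$ for all $p$, so that $C_\Delta^\bullet$ is a complex of sheaves of abelian groups on $\Delta$; and the canonical inclusion $j_!\mathbb Z_{\Delta^\circ}\hookrightarrow\mathbb Z_\Delta=C^0_\Delta$ has zero composition with $d^0$ and defines a quasi-isomorphism of complexes of sheaves on $\Delta$ $$j_!\,\mathbb Z_{\Delta^\circ}\;\xrightarrow{\ \sim\ }\;C_\Delta^\bullet ,$$ where $j_!\mathbb Z_{\Delta^\circ}$ is placed in degree $0$. -/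

import Mathlib

open CategoryTheory CategoryTheory.Limits TopologicalSpace

universe u

noncomputable section

/-! ### Constant sheaves `ℤ_S` and the extension by zero `j_! ℤ_S` -/

namespace CechPoly

/-- The presheaf of locally constant `ℤ`-valued functions. -/
def constPresheaf (X : TopCat.{u}) : X.Presheaf AddCommGrpCat.{u} where
  obj U := AddCommGrpCat.of (LocallyConstant U.unop ℤ)
  map f := AddCommGrpCat.ofHom (LocallyConstant.comapAddMonoidHom
    ⟨Set.inclusion f.unop.le, continuous_inclusion f.unop.le⟩)

theorem constPresheaf_isSheaf (X : TopCat.{u}) : (constPresheaf X).IsSheaf := by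
  rw [TopCat.Presheaf.isSheaf_iff_isSheafUniqueGluing]
  intro ι U sf hsf
  have hmem : ∀ x : ↥(iSup U), ∃ i, x.1 ∈ U i := fun x => by
    simpa using Opens.mem_iSup.1 x.2
  choose k hk using hmem
  have hcompat : ∀ (i j : ι) (x : X) (hi : x ∈ U i) (hj : x ∈ U j),
      (show LocallyConstant (U i) ℤ from sf i) ⟨x, hi⟩
        = (show LocallyConstant (U j) ℤ from sf j) ⟨x, hj⟩ := fun i j x hi hj =>
    DFunLike.congr_fun
      (show LocallyConstant.comap _ _ = LocallyConstant.comap _ _ from hsf i j)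
      (⟨x, hi, hj⟩ : (U i ⊓ U j : Opens X))
  let g : ↥(iSup U) → ℤ := fun x =>
    (show LocallyConstant (U (k x)) ℤ from sf (k x)) ⟨x.1, hk x⟩
  have hg : ∀ (i : ι) (x : ↥(iSup U)) (hi : x.1 ∈ U i),
      g x = (show LocallyConstant (U i) ℤ from sf i) ⟨x.1, hi⟩ := fun i x hi =>
    hcompat _ _ _ _ _
  have hloc : IsLocallyConstant g := by
    rw [IsLocallyConstant.iff_exists_open]
    intro x
    obtain ⟨W, hW, hxW, hc⟩ := (IsLocallyConstant.iff_exists_open _).1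
      (show LocallyConstant (U (k x)) ℤ from sf (k x)).isLocallyConstant ⟨x.1, hk x⟩
    obtain ⟨W', hW', rfl⟩ := isOpen_induced_iff.1 hW
    refine ⟨Subtype.val ⁻¹' (W' ∩ (U (k x) : Set X)),
      (hW'.inter (U (k x)).isOpen).preimage continuous_subtype_val, ⟨hxW, hk x⟩, ?_⟩
    rintro y ⟨hy1, hy2⟩
    rw [hg (k x) y hy2, hg (k x) x (hk x)]
    exact hc ⟨y.1, hy2⟩ hy1
  refine ⟨(⟨g, hloc⟩ : LocallyConstant ↥(iSup U) ℤ), fun i => ?_, fun s hs => ?_⟩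
  · refine LocallyConstant.ext fun x => ?_
    exact hg i ⟨x.1, _⟩ x.2
  · refine LocallyConstant.ext fun x => ?_
    have h1 := DFunLike.congr_fun (show LocallyConstant.comap _ _ = _ from hs (k x)) ⟨x.1, hk x⟩
    exact h1

/-- The constant sheaf `ℤ_X`: its sections are the locally constant `ℤ`-valued functions. -/
def constSheaf (X : TopCat.{u}) : X.Sheaf AddCommGrpCat.{u} :=
  ⟨constPresheaf X, constPresheaf_isSheaf X⟩

/-- `constSheaf X` is the sheafification of the constant presheaf with value `ℤ`. -/
theorem constSheaf_iso (X : TopCat.{u}) :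
    Nonempty ((constantSheaf (Opens.grothendieckTopology X) AddCommGrpCat.{u}).obj
      (AddCommGrpCat.of (ULift.{u} ℤ)) ≅ (show CategoryTheory.Sheaf _ _ from constSheaf X)) := by
  let φ : (Functor.const (Opens X)ᵒᵖ).obj (AddCommGrpCat.of (ULift.{u} ℤ)) ⟶ constPresheaf X :=
    { app := fun U => AddCommGrpCat.ofHom
        { toFun := fun m => LocallyConstant.const U.unop m.down
          map_zero' := rfl
          map_add' := fun _ _ => rfl }
      naturality := fun _ _ _ => rfl }
  have h1 : Presheaf.IsLocallyInjective (Opens.grothendieckTopology X) φ := by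
    refine ⟨fun {U} x y h p hp => ⟨U.unop, 𝟙 _, ?_, hp⟩⟩
    have h' := DFunLike.congr_fun (show LocallyConstant.const U.unop (ULift.down x) =
      LocallyConstant.const U.unop (ULift.down y) from h) ⟨p, hp⟩
    have : x = y := ULift.ext _ _ h'
    subst this
    exact rfl
  have h2 : Presheaf.IsLocallySurjective (Opens.grothendieckTopology X) φ := by
    refine ⟨fun {U} s p hp => ?_⟩
    let s' : LocallyConstant U ℤ := s
    refine ⟨⟨Subtype.val '' {x : U | s' x = s' ⟨p, hp⟩},
      U.isOpen.isOpenMap_subtype_val _ (s'.isLocallyConstant.isOpen_fiber _)⟩,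
      homOfLE (by rintro _ ⟨x, -, rfl⟩; exact x.2), ⟨ULift.up (s' ⟨p, hp⟩), ?_⟩, ⟨⟨p, hp⟩, rfl, rfl⟩⟩
    refine LocallyConstant.ext ?_
    rintro ⟨_, ⟨x, hx, rfl⟩⟩
    exact hx.symm
  have h3 := (GrothendieckTopology.W_iff _ φ).1
    (GrothendieckTopology.W_of_isLocallyBijective (J := Opens.grothendieckTopology X) φ)
  let F : CategoryTheory.Sheaf (Opens.grothendieckTopology X) AddCommGrpCat.{u} := constSheaf X
  have h4 : IsIso ((sheafificationAdjunction (Opens.grothendieckTopology X)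
    AddCommGrpCat.{u}).counit.app F) := inferInstance
  exact ⟨@asIso _ _ _ _ _ h3 ≪≫ @asIso _ _ _ _ _ h4⟩

/-- The inclusion `j_S : S → X` of a subset (with the subspace topology). -/
def incl {X : TopCat.{u}} (S : Set X) : TopCat.of S ⟶ X :=
  TopCat.ofHom ⟨Subtype.val, continuous_subtype_val⟩

/-- The sheaf `ℤ_S` on `X`: the direct image under the inclusion `S → X` of the constant sheaf
on `S`. Its sections over `U` are the locally constant functions `U ∩ S → ℤ`. -/
def constOn {X : TopCat.{u}} (S : Set X) : X.Sheaf AddCommGrpCat.{u} :=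
  (TopCat.Sheaf.pushforward _ (incl S)).obj (constSheaf (TopCat.of S))

/-- Restriction of functions `ℤ_A → ℤ_B` for `B ⊆ A`. -/
def restrHom {X : TopCat.{u}} {A B : Set X} (h : B ⊆ A) : constOn A ⟶ constOn B :=
  ⟨{ app := fun U => AddCommGrpCat.ofHom (LocallyConstant.comapAddMonoidHom
        (⟨fun x => ⟨⟨x.1.1, h x.1.2⟩, x.2⟩, by fun_prop⟩ :
          C((Opens.map (incl B)).obj U.unop, (Opens.map (incl A)).obj U.unop)))
     naturality := fun _ _ _ => rfl }⟩

/-- The support (in `X`) of a function on `S ∩ U`. -/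
def supp {X : TopCat.{u}} (S : Set X) (U : Opens X)
    (f : LocallyConstant ((Opens.map (incl S)).obj U) ℤ) : Set X :=
  {x | ∃ (hS : x ∈ S) (hU : x ∈ U), f ⟨⟨x, hS⟩, hU⟩ ≠ 0}

theorem exists_nhd {X : TopCat.{u}} (S : Set X) (U : Opens X)
    (f : LocallyConstant ((Opens.map (incl S)).obj U) ℤ) (x : X) (hS : x ∈ S) (hU : x ∈ U) :
    ∃ W : Set X, IsOpen W ∧ x ∈ W ∧ ∀ (y : X) (hyS : y ∈ S) (hyU : y ∈ U), y ∈ W →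
      f ⟨⟨y, hyS⟩, hyU⟩ = f ⟨⟨x, hS⟩, hU⟩ := by
  obtain ⟨W, hW, hxW, hc⟩ := (IsLocallyConstant.iff_exists_open _).1 f.isLocallyConstant
    ⟨⟨x, hS⟩, hU⟩
  obtain ⟨W', hW', rfl⟩ := isOpen_induced_iff.1 hW
  obtain ⟨W'', hW'', rfl⟩ := isOpen_induced_iff.1 hW'
  exact ⟨W'', hW'', hxW, fun y hyS hyU hy => hc ⟨⟨y, hyS⟩, hyU⟩ hy⟩

theorem isClosed_supp_iff {X : TopCat.{u}} (S : Set X) (U : Opens X)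
    (f : LocallyConstant ((Opens.map (incl S)).obj U) ℤ) :
    IsClosed (Subtype.val ⁻¹' supp S U f : Set U) ↔
      ∀ x ∈ U, x ∈ closure (supp S U f) → x ∈ S := by
  have hsub : (U : Set X) ∩ supp S U f = supp S U f :=
    Set.inter_eq_right.2 fun x ⟨_, hU, _⟩ => hU
  rw [isClosed_preimage_val, hsub]
  refine ⟨fun h x hU hx => (h ⟨hU, hx⟩).1, fun h x ⟨hU, hx⟩ => ?_⟩
  have hS := h x hU hx
  obtain ⟨W, hW, hxW, hc⟩ := exists_nhd S U f x hS hU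
  obtain ⟨y, hyW, hyS, hyU, hy⟩ := mem_closure_iff.1 hx W hW hxW
  exact ⟨hS, hU, by rwa [← hc y hyS hyU hyW]⟩

/-- The sections over `U` of `j_! ℤ_S`: the sections of the constant sheaf over `S ∩ U` whose
support is closed in `U`. -/
def shriekSections {X : TopCat.{u}} (S : Set X) (U : Opens X) :
    AddSubgroup (LocallyConstant ((Opens.map (incl S)).obj U) ℤ) where
  carrier := {f | IsClosed (Subtype.val ⁻¹' supp S U f : Set U)}
  zero_mem' := by
    have : (Subtype.val ⁻¹' supp S U 0 : Set U) = ∅ := by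
      ext x; simp [supp]
    change IsClosed _
    rw [this]
    exact isClosed_empty
  add_mem' := by
    intro f g hf hg
    have hf' := (isClosed_supp_iff S U f).1 hf
    have hg' := (isClosed_supp_iff S U g).1 hg
    refine (isClosed_supp_iff S U (f + g)).2 fun x hU hx => ?_
    have hsub : supp S U (f + g) ⊆ supp S U f ∪ supp S U g := by
      rintro y ⟨hS, hyU, hy⟩
      by_cases h : f ⟨⟨y, hS⟩, hyU⟩ = 0
      · refine Or.inr ⟨hS, hyU, fun h' => hy ?_⟩
        rw [LocallyConstant.add_apply, h, h', add_zero]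
      · exact Or.inl ⟨hS, hyU, h⟩
    have hx' := closure_mono hsub hx
    rw [closure_union] at hx'
    exact hx'.elim (hf' x hU) (hg' x hU)
  neg_mem' := by
    intro f hf
    have : (Subtype.val ⁻¹' supp S U (-f) : Set U) = Subtype.val ⁻¹' supp S U f := by
      ext x; simp [supp]
    change IsClosed _
    rw [this]
    exact hf

/-- Restriction of locally constant functions on `S ∩ U` to `S ∩ U'`. -/
def resPart {X : TopCat.{u}} (S : Set X) {U U' : Opens X} (h : U' ≤ U) :
    LocallyConstant ((Opens.map (incl S)).obj U) ℤ →+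
      LocallyConstant ((Opens.map (incl S)).obj U') ℤ :=
  LocallyConstant.comapAddMonoidHom
    ⟨fun x => ⟨x.1, h x.2⟩, continuous_subtype_val.subtype_mk _⟩

theorem resPart_mem {X : TopCat.{u}} (S : Set X) {U U' : Opens X} (h : U' ≤ U)
    (f : LocallyConstant ((Opens.map (incl S)).obj U) ℤ) (hf : f ∈ shriekSections S U) :
    resPart S h f ∈ shriekSections S U' := by
  refine (isClosed_supp_iff S U' _).2 fun x hU hx => ?_
  refine (isClosed_supp_iff S U f).1 hf x (h hU) (closure_mono ?_ hx)
  rintro y ⟨hS, hyU, hy⟩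
  exact ⟨hS, h hyU, hy⟩

/-- The presheaf `U ↦ {s ∈ Γ(S ∩ U, ℤ) | supp s is closed in U}`. -/
def shriekPresheaf {X : TopCat.{u}} (S : Set X) : X.Presheaf AddCommGrpCat.{u} where
  obj U := AddCommGrpCat.of (shriekSections S U.unop)
  map {U U'} f := AddCommGrpCat.ofHom
    (((resPart S f.unop.le).comp (shriekSections S U.unop).subtype).codRestrict
      (shriekSections S U'.unop) fun s => resPart_mem S f.unop.le s.1 s.2)

theorem shriekPresheaf_isSheaf {X : TopCat.{u}} (S : Set X) : (shriekPresheaf S).IsSheaf := by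
  rw [TopCat.Presheaf.isSheaf_iff_isSheafUniqueGluing]
  intro ι U sf hsf
  obtain ⟨s, hs, huniq⟩ := (constOn S).existsUnique_gluing U
    (fun i => (show shriekSections S (U i) from sf i).1)
    (fun i j => congrArg Subtype.val (hsf i j))
  have hs' : ∀ (i : ι) (y : X) (hS : y ∈ S) (hy : y ∈ U i),
      (show LocallyConstant ((Opens.map (incl S)).obj (iSup U)) ℤ from s)
        ⟨⟨y, hS⟩, Opens.mem_iSup.2 ⟨i, hy⟩⟩ =
      (show shriekSections S (U i) from sf i).1 ⟨⟨y, hS⟩, hy⟩ := fun i y hS hy =>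
    DFunLike.congr_fun (show LocallyConstant.comap _ _ = _ from hs i) ⟨⟨y, hS⟩, hy⟩
  have hmem : (show LocallyConstant ((Opens.map (incl S)).obj (iSup U)) ℤ from s) ∈
      shriekSections S (iSup U) := by
    refine (isClosed_supp_iff S _ _).2 fun x hU hx => ?_
    obtain ⟨i, hi⟩ := Opens.mem_iSup.1 hU
    refine (isClosed_supp_iff S (U i) _).1 (show shriekSections S (U i) from sf i).2 x hi ?_
    rw [mem_closure_iff] at hx ⊢
    intro W hW hxW
    obtain ⟨y, ⟨hyW, hyi⟩, hyS, hyU, hy⟩ := hx (W ∩ U i) (hW.inter (U i).isOpen) ⟨hxW, hi⟩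
    refine ⟨y, hyW, hyS, hyi, ?_⟩
    rw [← hs' i y hyS hyi]
    exact hy
  refine ⟨(⟨s, hmem⟩ : shriekSections S (iSup U)), fun i => Subtype.ext (hs i), fun t ht => ?_⟩
  exact Subtype.ext (huniq (show shriekSections S (iSup U) from t).1
    fun i => congrArg Subtype.val (ht i))

/-- The extension by zero `j_! ℤ_S` of the constant sheaf `ℤ_S` on a (locally closed) subset
`S ⊆ X`. -/
def extByZero {X : TopCat.{u}} (S : Set X) : X.Sheaf AddCommGrpCat.{u} :=
  ⟨shriekPresheaf S, shriekPresheaf_isSheaf S⟩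

open Classical in
/-- For `S` open, extending by zero a function on `S ∩ U` with support closed in `U`
gives a locally constant function on `U`. -/
def zeroExt {X : TopCat.{u}} {S : Set X} (hS : IsOpen S) (U : Opens X)
    (f : shriekSections S U) : LocallyConstant U ℤ where
  toFun x := if h : x.1 ∈ S then f.1 ⟨⟨x.1, h⟩, x.2⟩ else 0
  isLocallyConstant := by
    rw [IsLocallyConstant.iff_exists_open]
    intro x
    by_cases hx : x.1 ∈ S
    · obtain ⟨W, hW, hxW, hc⟩ := exists_nhd S U f.1 x.1 hx x.2
      refine ⟨Subtype.val ⁻¹' (W ∩ S), (hW.inter hS).preimage continuous_subtype_val,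
        ⟨hxW, hx⟩, ?_⟩
      rintro y ⟨hyW, hyS⟩
      rw [dif_pos hyS, dif_pos hx]
      exact hc y.1 hyS y.2 hyW
    · refine ⟨(Subtype.val ⁻¹' supp S U f.1)ᶜ, f.2.isOpen_compl, fun h => hx h.1, ?_⟩
      intro y hy
      rw [dif_neg hx]
      split_ifs with hyS
      · by_contra hne
        exact hy ⟨hyS, y.2, hne⟩
      · rfl

/-- For `S` open in `X` and any `A ⊆ X`, the canonical morphism `j_! ℤ_S → ℤ_X → ℤ_A`: extend
functions by zero, then restrict them to `A`. -/
def extRestrHom {X : TopCat.{u}} {S : Set X} (hS : IsOpen S) (A : Set X) :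
    extByZero S ⟶ constOn A :=
  ⟨{ app := fun U => AddCommGrpCat.ofHom <| (LocallyConstant.comapAddMonoidHom
        (⟨fun x => ⟨x.1.1, x.2⟩, by fun_prop⟩ :
          C((Opens.map (incl A)).obj U.unop, U.unop))).comp
        { toFun := zeroExt hS U.unop
          map_zero' := by
            refine LocallyConstant.ext fun x => ?_
            simp [zeroExt]
          map_add' := fun f g => by
            refine LocallyConstant.ext fun x => ?_
            by_cases h : x.1 ∈ S <;> simp [zeroExt, h] }
     naturality := fun _ _ _ => rfl }⟩

/-! ### Polyhedra and their faces -/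

/-- A polyhedron in a real vector space: the set of solutions of finitely many (non-strict,
affine) linear inequalities. -/
structure Polyhedron (V : Type u) [AddCommGroup V] [Module ℝ V] where
  carrier : Set V
  exists_finset : ∃ I : Finset (Module.Dual ℝ V × ℝ), carrier = {x | ∀ p ∈ I, p.1 x ≤ p.2}

namespace Polyhedron

variable {V : Type u} [AddCommGroup V] [Module ℝ V] [TopologicalSpace V]

/-- The faces of `Δ`: the nonempty subsets of `Δ` on which some linear functional attains its
extremal value on `Δ`. The zero functional gives the face `Δ` itself. -/
structure Face (Δ : Polyhedron V) where
  carrier : Set V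
  isExposed : IsExposed ℝ Δ.carrier carrier
  nonempty : carrier.Nonempty

namespace Face

variable {Δ : Polyhedron V}

/-- The direction of (the affine span of) a face. -/
abbrev direction (σ : Δ.Face) : Submodule ℝ V := vectorSpan ℝ σ.carrier

/-- The dimension of a face. -/
def dim (σ : Δ.Face) : ℕ := Module.finrank ℝ σ.direction

/-- The codimension of a face in the ambient vector space. -/
def codim (σ : Δ.Face) : ℕ := Module.finrank ℝ V - σ.dim

theorem ext_carrier {σ τ : Δ.Face} (h : σ.carrier = τ.carrier) : σ = τ := by
  cases σ; cases τ; cases h; rfl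

end Face

/-- A polyhedron has only finitely many faces: a face is determined by the defining inequalities
which are equalities on it. -/
instance finite_face (Δ : Polyhedron V) : Finite Δ.Face := by
  classical
  obtain ⟨I, hI⟩ := Δ.exists_finset
  have key : ∀ σ τ : Δ.Face,
      I.filter (fun p => ∀ x ∈ σ.carrier, p.1 x = p.2) ⊆
        I.filter (fun p => ∀ x ∈ τ.carrier, p.1 x = p.2) → τ.carrier ⊆ σ.carrier := by
    intro σ τ hst x hx
    have hxΔ : x ∈ Δ.carrier := τ.isExposed.subset hx
    obtain ⟨l, hl⟩ := σ.isExposed σ.nonempty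
    obtain ⟨z₀, hz₀⟩ := σ.nonempty
    -- a point of `σ` at which all inequalities that are not equalities on `σ` are strict
    have hz : ∀ J : Finset (Module.Dual ℝ V × ℝ), J ⊆ I → ∃ z ∈ σ.carrier, ∀ p ∈ J,
        (¬ ∀ x ∈ σ.carrier, p.1 x = p.2) → p.1 z < p.2 := by
      intro J
      induction J using Finset.induction_on with
      | empty => exact fun _ => ⟨z₀, hz₀, by simp⟩
      | insert q J _ ih =>
        intro hJ
        obtain ⟨z, hzσ, hz⟩ := ih fun p hp => hJ (Finset.mem_insert_of_mem hp)
        by_cases hq : ∀ x ∈ σ.carrier, q.1 x = q.2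
        · refine ⟨z, hzσ, fun p hp hne => ?_⟩
          rcases Finset.mem_insert.1 hp with rfl | hp
          · exact absurd hq hne
          · exact hz p hp hne
        · push Not at hq
          obtain ⟨y, hyσ, hy⟩ := hq
          have hyI : ∀ p ∈ I, p.1 y ≤ p.2 := by
            have := σ.isExposed.subset hyσ; rw [hI] at this; exact this
          have hzI : ∀ p ∈ I, p.1 z ≤ p.2 := by
            have := σ.isExposed.subset hzσ; rw [hI] at this; exact this
          refine ⟨(1 / 2 : ℝ) • z + (1 / 2 : ℝ) • y, ?_, fun p hp hne => ?_⟩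
          · rw [hl] at hzσ hyσ ⊢
            refine ⟨?_, fun w hw => ?_⟩
            · rw [hI]
              intro p hp
              have h1 := hyI p hp
              have h2 := hzI p hp
              simp only [map_add, map_smul, smul_eq_mul]
              linarith
            · have h1 := hzσ.2 w hw
              have h2 := hyσ.2 w hw
              simp only [map_add, map_smul, smul_eq_mul]
              linarith
          · have h1 := hyI p (hJ hp)
            have h2 := hzI p (hJ hp)
            simp only [map_add, map_smul, smul_eq_mul]
            rcases Finset.mem_insert.1 hp with rfl | hp'
            · have := lt_of_le_of_ne h1 hy
              linarith
            · have := hz p hp' hne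
              linarith
    obtain ⟨z, hzσ, hz⟩ := hz I (Finset.Subset.refl _)
    have hxI : ∀ p ∈ I, p.1 x ≤ p.2 := by rw [hI] at hxΔ; exact hxΔ
    -- moving slightly from `z` away from `x` stays in the polyhedron
    have ht : ∀ J : Finset (Module.Dual ℝ V × ℝ), J ⊆ I → ∃ t : ℝ, 0 < t ∧ ∀ p ∈ J,
        p.1 (z + t • (z - x)) ≤ p.2 := by
      intro J
      induction J using Finset.induction_on with
      | empty => exact fun _ => ⟨1, one_pos, by simp⟩
      | insert q J _ ih =>
        intro hJ
        obtain ⟨t, ht0, ht⟩ := ih fun p hp => hJ (Finset.mem_insert_of_mem hp)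
        have hqI : q ∈ I := hJ (Finset.mem_insert_self _ _)
        have hzI : ∀ p ∈ I, p.1 z ≤ p.2 := by
          have := σ.isExposed.subset hzσ; rw [hI] at this; exact this
        obtain ⟨s, hs0, hs⟩ : ∃ s : ℝ, 0 < s ∧ ∀ r, 0 ≤ r → r ≤ s →
            q.1 (z + r • (z - x)) ≤ q.2 := by
          simp only [map_add, map_smul, map_sub, smul_eq_mul]
          by_cases hq : ∀ x ∈ σ.carrier, q.1 x = q.2
          · have h1 := hq z hzσ
            have h2 : q.1 x = q.2 :=
              (Finset.mem_filter.1 (hst (Finset.mem_filter.2 ⟨hqI, hq⟩))).2 x hx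
            exact ⟨1, one_pos, fun r _ _ => by rw [h1, h2]; simp⟩
          · have h1 := hz q hqI hq
            have h2 := hxI q hqI
            have h3 : 0 < q.2 - q.1 z := by linarith
            have h4 : 0 < |q.1 z - q.1 x| + 1 := by positivity
            refine ⟨(q.2 - q.1 z) / (|q.1 z - q.1 x| + 1), by positivity, fun r hr hrs => ?_⟩
            rw [le_div_iff₀ h4] at hrs
            have h5 := mul_le_mul_of_nonneg_left (le_abs_self (q.1 z - q.1 x)) hr
            nlinarith
        refine ⟨min s t, lt_min hs0 ht0, fun p hp => ?_⟩
        rcases Finset.mem_insert.1 hp with rfl | hp'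
        · exact hs _ (lt_min hs0 ht0).le (min_le_left _ _)
        · have h1 := ht p hp'
          have h2 := hzI p (hJ hp)
          simp only [map_add, map_smul, map_sub, smul_eq_mul] at h1 ⊢
          have h3 : min s t ≤ t := min_le_right _ _
          have h4 : 0 < min s t := lt_min hs0 ht0
          rcases le_total 0 (p.1 z - p.1 x) with h | h
          · nlinarith
          · nlinarith
    obtain ⟨t, ht0, ht⟩ := ht I (Finset.Subset.refl _)
    rw [hl] at hzσ ⊢
    refine ⟨hxΔ, fun w hw => (hzσ.2 w hw).trans ?_⟩
    have h1 := hzσ.2 (z + t • (z - x)) (by rw [hI]; exact ht)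
    simp only [map_add, map_smul, map_sub, smul_eq_mul] at h1
    nlinarith
  refine Finite.of_injective (β := ↥I.powerset) (fun σ =>
    ⟨I.filter (fun p => ∀ x ∈ σ.carrier, p.1 x = p.2),
      Finset.mem_powerset.2 (Finset.filter_subset _ _)⟩) fun σ τ h => ?_
  have h' := congrArg Subtype.val h
  exact Face.ext_carrier ((key τ σ h'.ge).antisymm (key σ τ h'.le))

/-- A choice of an orientation of each face. -/
abbrev Orientations (Δ : Polyhedron V) : Type u :=
  ∀ σ : Δ.Face, Orientation ℝ σ.direction (Fin σ.dim)

/-- For a facet `τ` of `σ`: the orientations of `σ` and `τ` agree if, for a basis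
`v₁, …, v_d` of the direction of `τ` and a vector `w` pointing from a point of `τ` into `σ`,
the basis `v₁, …, v_d` is positive for `τ` exactly when `w, v₁, …, v_d` is positive for `σ`. -/
def Coherent {Δ : Polyhedron V} (o : Δ.Orientations) (σ τ : Δ.Face) : Prop :=
  ∃ (h : τ.dim + 1 = σ.dim) (v : Module.Basis (Fin τ.dim) ℝ τ.direction)
    (w : Module.Basis (Fin σ.dim) ℝ σ.direction),
    (∃ x ∈ σ.carrier \ τ.carrier, ∃ y ∈ τ.carrier, (w (Fin.cast h 0) : V) = x - y) ∧
    (∀ i : Fin τ.dim, (w (Fin.cast h i.succ) : V) = v i) ∧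
    (w.orientation = o σ ↔ v.orientation = o τ)

open Classical in
/-- The incidence number `±1` of a face `σ` and a facet `τ` of `σ`. -/
def incidence {Δ : Polyhedron V} (o : Δ.Orientations) (σ τ : Δ.Face) : ℤ :=
  if Coherent o σ τ then 1 else -1

/-! ### The Čech type complex -/

/-- `Δ` as a topological space. -/
abbrev space (Δ : Polyhedron V) : TopCat.{u} := TopCat.of Δ.carrier

/-- A face as a subset of the space `Δ`. -/
def Face.toSet {Δ : Polyhedron V} (σ : Δ.Face) : Set Δ.space := Subtype.val ⁻¹' σ.carrier

/-- The interior `Δ°` (in `V`) as a subset of the space `Δ`. -/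
def interiorSet (Δ : Polyhedron V) : Set Δ.space := Subtype.val ⁻¹' interior Δ.carrier

theorem isOpen_interiorSet (Δ : Polyhedron V) : IsOpen Δ.interiorSet :=
  isOpen_interior.preimage continuous_subtype_val

/-- The faces of codimension `p`. -/
abbrev FacesOfCodim (Δ : Polyhedron V) (p : ℕ) : Type u := {σ : Δ.Face // σ.codim = p}

instance hasFiniteBiproducts_sheaf (X : TopCat.{u}) :
    HasFiniteBiproducts (X.Sheaf AddCommGrpCat.{u}) :=
  Abelian.hasFiniteBiproducts

/-- `C^p = ⨁_{codim σ = p} ℤ_σ`. -/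
def cechX (Δ : Polyhedron V) (p : ℕ) : Δ.space.Sheaf AddCommGrpCat.{u} :=
  ⨁ fun σ : Δ.FacesOfCodim p => constOn σ.1.toSet

open Classical in
/-- The differential `C^p → C^(p+1)`: the component `ℤ_σ → ℤ_τ` is the restriction morphism times
the incidence number if `τ ⊆ σ`, and zero otherwise. -/
def cechD {Δ : Polyhedron V} (o : Δ.Orientations) (p : ℕ) : Δ.cechX p ⟶ Δ.cechX (p + 1) :=
  biproduct.desc fun σ : Δ.FacesOfCodim p => biproduct.lift fun τ : Δ.FacesOfCodim (p + 1) =>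
    if h : τ.1.toSet ⊆ σ.1.toSet then incidence o σ.1 τ.1 • restrHom h
    else 0

/-- The canonical morphism `j_! ℤ_{Δ°} → C^0` (when `dim Δ = dim V`, the only face of codimension
`0` is `Δ` itself, so that `C^0 = ℤ_Δ` and this is the inclusion `j_! ℤ_{Δ°} → ℤ_Δ`). -/
def cechAug (Δ : Polyhedron V) : extByZero Δ.interiorSet ⟶ Δ.cechX 0 :=
  biproduct.lift fun σ => extRestrHom Δ.isOpen_interiorSet σ.1.toSet

/-- The complex `C_Δ`, once the differentials are known to have square zero. -/
def cechComplex {Δ : Polyhedron V} (o : Δ.Orientations)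
    (hd : ∀ p, cechD o p ≫ cechD o (p + 1) = 0) :
    CochainComplex (Δ.space.Sheaf AddCommGrpCat.{u}) ℕ :=
  CochainComplex.of Δ.cechX (cechD o) hd

/-- The morphism of complexes `j_! ℤ_{Δ°} → C_Δ` given by `cechAug` in degree `0`, where
`j_! ℤ_{Δ°}` is placed in degree `0`. -/
def cechMap {Δ : Polyhedron V} (o : Δ.Orientations)
    (hd : ∀ p, cechD o p ≫ cechD o (p + 1) = 0) (ha : Δ.cechAug ≫ cechD o 0 = 0) :
    (CochainComplex.single₀ _).obj (extByZero Δ.interiorSet) ⟶ cechComplex o hd :=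
  (CochainComplex.fromSingle₀Equiv (cechComplex o hd) (extByZero Δ.interiorSet)).symm
    ⟨Δ.cechAug, by
      refine Eq.trans ?_ ha
      exact congrArg (fun f => Δ.cechAug ≫ f)
        (CochainComplex.of_d Δ.cechX (cechD o) 0)⟩

end Polyhedron

end CechPoly

end

/-! Everything is local and can be tested on values of sections. On a small convex neighbourhood of
`x` that meets only the faces through `x`, a section of `C^p` is constant on each face
(`exists_good_neighbourhood`), so it amounts to a cellular chain on the faces through `x`
(`chainAt`), and the differential becomes the boundary matrix `boundaryCoeff`
(`cechEval_cechD_eq_sum`). Two combinatorial facts remain.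

The matrix squares to zero (`sum_boundaryCoeff_mul`). Between two faces whose dimensions differ by
two there are exactly two faces. With orientations written as alternating forms, the two products of
incidence numbers are the signs of one expression in which two vectors are interchanged, so they
cancel.

The faces through `x` form an interval `[G, Δ]`, where `G` is the least face containing `x`, and `G
< Δ` exactly when `x` is a boundary point. At an interior point only `Δ` is left, which matches the
value ℤ of the extension by zero. At a boundary point the complex must be acyclic
(`isAcyclicOn_Icc`). This is shown without topology, by a sweep. If `h` exposes `G` and `g` is
constant on `G`, the ratio of `g` and `h`, normalised to vanish on `G`, attains a maximum over every
face `F > G` exactly on a face `A > G` (`exists_maxRatio_face`). Sorting faces by the maximal ratio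
and then by `A` filters the complex, and `IsAcyclicOn.of_fibers` reduces the claim to the blocks. A
block is not an interval, but the part of a smaller interval on which some functional decreases away
from the bottom face. Hence the induction on dimension is run for such `descending` families
(`isAcyclicOn_descending`); it ends at two-element intervals, whose single coefficient is ±1. -/

noncomputable section

/-! ### Exactness and quasi-isomorphisms tested on local sections. -/

namespace TopCat.Sheaf

open Opposite

/-- Exactness is a condition on stalks, and a germ killed by the second map is represented, after
shrinking, by a section killed by it. -/
theorem exact_of_locally_exact {X : TopCat.{u}} (S : ShortComplex (X.Sheaf AddCommGrpCat.{u}))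
    (h : ∀ (x : X) (U : Opens X) (_ : x ∈ U) (s : S.X₂.obj.obj (op U)),
      S.g.hom.app (op U) s = 0 → ∃ (W : Opens X) (_ : x ∈ W) (hWU : W ≤ U)
        (t : S.X₁.obj.obj (op W)),
        S.f.hom.app (op W) t = S.X₂.obj.map (homOfLE hWU).op s) : S.Exact := by
  rw [exact_iff_stalkFunctor_map_exact]
  intro x
  rw [ShortComplex.ab_exact_iff]
  intro z hz
  obtain ⟨U, hxU, s, rfl⟩ := TopCat.Presheaf.exists_germ_eq S.X₂.obj z
  have hz' : TopCat.Presheaf.germ S.X₃.obj U x hxU (S.g.hom.app (op U) s) = TopCat.Presheaf.germ S.X₃.obj U x hxU 0 := by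
    rw [map_zero]
    refine Eq.trans ?_ hz
    exact (TopCat.Presheaf.stalkFunctor_map_germ_apply U x hxU S.g.hom s).symm
  obtain ⟨W, hxW, i₁, i₂, e⟩ := TopCat.Presheaf.germ_eq _ x hxU hxU _ _ hz'
  have e' : S.g.hom.app (op W) (S.X₂.obj.map i₁.op s) = 0 := by
    rw [map_zero] at e
    rw [← e]
    exact ConcreteCategory.congr_hom (S.g.hom.naturality i₁.op) s
  obtain ⟨W', hxW', hle, t, ht⟩ := h x W hxW _ e'
  refine ⟨TopCat.Presheaf.germ S.X₁.obj W' x hxW' t, ?_⟩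
  refine (TopCat.Presheaf.stalkFunctor_map_germ_apply W' x hxW' S.f.hom t).trans ?_
  rw [ht, TopCat.Presheaf.germ_res_apply, TopCat.Presheaf.germ_res_apply]

theorem mono_of_injective {X : TopCat.{u}} {F G : X.Sheaf AddCommGrpCat.{u}} (f : F ⟶ G)
    (h : ∀ (U : Opens X) (s : F.obj.obj (op U)), f.hom.app (op U) s = 0 → s = 0) : Mono f := by
  have : ∀ U, Mono (f.hom.app U) := fun U => by
    rw [AddCommGrpCat.mono_iff_injective]
    exact (injective_iff_map_eq_zero (f.hom.app U).hom).2 (h U.unop)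
  have : Mono f.hom := NatTrans.mono_of_mono_app _
  exact (TopCat.Sheaf.forget AddCommGrpCat.{u} X).mono_of_mono_map this

end TopCat.Sheaf

namespace CategoryTheory

/-- In degree 0 a quasi-isomorphism from a single object means that the augmented complex is exact
at `A` and at `K.X 0`; in positive degrees the source has no cohomology, so `K` must be exact there.
-/
theorem quasiIso_fromSingle₀ {C : Type*} [Category C] [Abelian C] (K : CochainComplex C ℕ) (A : C)
    (f : A ⟶ K.X 0) (hf : f ≫ K.d 0 1 = 0) (hm : Mono f) (h0 : (ShortComplex.mk f (K.d 0 1) hf).Exact)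
    (hK : ∀ n, K.ExactAt (n + 1)) :
    QuasiIso ((CochainComplex.fromSingle₀Equiv K A).symm ⟨f, hf⟩) where
  quasiIsoAt n := by
    cases n
    · rw [CochainComplex.quasiIsoAt₀_iff, ShortComplex.quasiIso_iff_of_zeros]
      · refine (ShortComplex.exact_and_mono_f_iff_of_iso ?_).2 ⟨h0, by dsimp; infer_instance⟩
        refine ShortComplex.isoMk (Iso.refl _) (Iso.refl _) (Iso.refl _) ?_ ?_
        · refine (Category.id_comp f).trans ((Category.comp_id f).symm.trans ?_)
          exact congrArg (fun g => g ≫ 𝟙 (K.X 0))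
            (CochainComplex.fromSingle₀Equiv_symm_apply_f_zero f hf).symm
        · exact (Category.id_comp _).trans (Category.comp_id _).symm
      · rfl
      · rfl
      · exact K.shape 0 0 (by simp)
    · rw [quasiIsoAt_iff_exactAt]
      · apply hK
      · apply CochainComplex.exactAt_succ_single_obj

end CategoryTheory

/-! ### Sections of the complex described by their values at points. -/

namespace CechPoly

open Opposite

/-- The sections of a sheaf over an open set. -/
def Sections {X : TopCat.{u}} (F : X.Sheaf AddCommGrpCat.{u}) (U : Opens X) : Type u :=
  F.obj.obj (op U)

instance {X : TopCat.{u}} (F : X.Sheaf AddCommGrpCat.{u}) (U : Opens X) :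
    AddCommGroup (Sections F U) :=
  inferInstanceAs (AddCommGroup (F.obj.obj (op U)))

/-- Restriction of sections. -/
def Sections.res {X : TopCat.{u}} {F : X.Sheaf AddCommGrpCat.{u}} {U W : Opens X} (h : W ≤ U) :
    Sections F U →+ Sections F W :=
  (F.obj.map (homOfLE h).op).hom

/-- The action of morphisms of sheaves on the sections over an open set. -/
def onSections {X : TopCat.{u}} (F G : X.Sheaf AddCommGrpCat.{u}) (U : Opens X) :
    (F ⟶ G) →+ (Sections F U →+ Sections G U) where
  toFun f := (f.hom.app (op U)).hom
  map_zero' := rfl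
  map_add' _ _ := rfl

theorem onSections_comp {X : TopCat.{u}} {F G H : X.Sheaf AddCommGrpCat.{u}} (U : Opens X)
    (f : F ⟶ G) (g : G ⟶ H) (s : Sections F U) :
    onSections F H U (f ≫ g) s = onSections G H U g (onSections F G U f s) := rfl

theorem hom_ext_onSections {X : TopCat.{u}} {F G : X.Sheaf AddCommGrpCat.{u}} {f g : F ⟶ G}
    (h : ∀ U s, onSections F G U f s = onSections F G U g s) : f = g := by
  apply CategoryTheory.Sheaf.hom_ext
  ext U s
  exact h U.unop s

/-- The value at a point of a section of `ℤ_S`. -/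
def pointEval {X : TopCat.{u}} (S : Set X) (U : Opens X) (x : X) (hS : x ∈ S) (hU : x ∈ U) :
    Sections (constOn S) U →+ ℤ where
  toFun f := (show LocallyConstant ((Opens.map (incl S)).obj U) ℤ from f) ⟨⟨x, hS⟩, hU⟩
  map_zero' := rfl
  map_add' _ _ := rfl

theorem pointEval_ext {X : TopCat.{u}} {S : Set X} {U : Opens X}
    {s t : Sections (constOn S) U}
    (h : ∀ x hS hU, pointEval S U x hS hU s = pointEval S U x hS hU t) : s = t :=
  LocallyConstant.ext fun x => h x.1.1 x.1.2 x.2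

namespace Polyhedron

variable {V : Type u} [AddCommGroup V] [Module ℝ V] [TopologicalSpace V] {Δ : Polyhedron V}

instance (Δ : Polyhedron V) (p : ℕ) : Finite (Δ.FacesOfCodim p) := Subtype.finite

/-- The projections of `C^p` to its summands. -/
def cechπ {p : ℕ} (σ : Δ.FacesOfCodim p) : Δ.cechX p ⟶ constOn σ.1.toSet :=
  biproduct.π (fun σ : Δ.FacesOfCodim p => constOn σ.1.toSet) σ

/-- The inclusions of the summands of `C^p`. -/
def cechι {p : ℕ} (σ : Δ.FacesOfCodim p) : constOn σ.1.toSet ⟶ Δ.cechX p :=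
  biproduct.ι (fun σ : Δ.FacesOfCodim p => constOn σ.1.toSet) σ

theorem cechι_π_self {p : ℕ} (σ : Δ.FacesOfCodim p) : cechι σ ≫ cechπ σ = 𝟙 _ :=
  biproduct.ι_π_self _ σ

theorem cechι_π_ne {p : ℕ} {σ τ : Δ.FacesOfCodim p} (h : σ ≠ τ) : cechι σ ≫ cechπ τ = 0 :=
  biproduct.ι_π_ne _ h

theorem sum_cechπ_ι {p : ℕ} [Fintype (Δ.FacesOfCodim p)] :
    ∑ σ : Δ.FacesOfCodim p, cechπ σ ≫ cechι σ = 𝟙 (Δ.cechX p) := by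
  classical
  refine biproduct.hom_ext' _ _ fun τ => ?_
  change cechι τ ≫ _ = cechι τ ≫ _
  rw [Preadditive.comp_sum, Finset.sum_eq_single τ, ← Category.assoc, cechι_π_self,
    Category.id_comp, Category.comp_id]
  · intro σ _ h
    rw [← Category.assoc, cechι_π_ne h.symm, zero_comp]
  · simp

open Classical in
theorem cechι_d_π (o : Δ.Orientations) {p : ℕ} (σ : Δ.FacesOfCodim p)
    (τ : Δ.FacesOfCodim (p + 1)) : cechι σ ≫ cechD o p ≫ cechπ τ =
      if h : τ.1.toSet ⊆ σ.1.toSet then incidence o σ.1 τ.1 • restrHom h else 0 := by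
  unfold cechι cechD cechπ
  erw [biproduct.ι_desc_assoc, biproduct.lift_π]

theorem cechAug_π (σ : Δ.FacesOfCodim 0) :
    Δ.cechAug ≫ cechπ σ = extRestrHom Δ.isOpen_interiorSet σ.1.toSet :=
  biproduct.lift_π _ _

/-- The value at a point of the `σ`-component of a section of `C^p`. -/
def cechEval {p : ℕ} (U : Opens Δ.space) (σ : Δ.FacesOfCodim p) (x : Δ.space)
    (hx : x ∈ σ.1.toSet) (hU : x ∈ U) : Sections (Δ.cechX p) U →+ ℤ :=
  (pointEval σ.1.toSet U x hx hU).comp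
    (onSections _ _ U (cechπ σ))

theorem sum_onSections_ι_π {p : ℕ} [Fintype (Δ.FacesOfCodim p)] (U : Opens Δ.space)
    (s : Sections (Δ.cechX p) U) :
    ∑ σ, onSections _ _ U (cechι σ)
      (onSections _ _ U (cechπ σ) s)
      = s := by
  have h := congrArg (fun f => onSections _ _ U f s) (sum_cechπ_ι (Δ := Δ) (p := p))
  rw [map_sum, AddMonoidHom.finsetSum_apply] at h
  exact h

theorem cechEval_ext {p : ℕ} {U : Opens Δ.space} {s t : Sections (Δ.cechX p) U}
    (h : ∀ σ x hx hU, cechEval U σ x hx hU s = cechEval U σ x hx hU t) : s = t := by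
  have := Fintype.ofFinite (Δ.FacesOfCodim p)
  rw [← sum_onSections_ι_π U s, ← sum_onSections_ι_π U t]
  refine Finset.sum_congr rfl fun σ _ => congrArg _ (pointEval_ext fun x hS hU => h σ x hS hU)

theorem cechEval_map {p : ℕ} {U W : Opens Δ.space} (hWU : W ≤ U) (σ : Δ.FacesOfCodim p)
    (x : Δ.space) (hx : x ∈ σ.1.toSet) (hW : x ∈ W) (s : Sections (Δ.cechX p) U) :
    cechEval W σ x hx hW (Sections.res hWU s) =
      cechEval U σ x hx (hWU hW) s := by
  have := ConcreteCategory.congr_hom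
    ((cechπ σ).hom.naturality
      (homOfLE hWU).op) s
  exact congrArg (pointEval σ.1.toSet W x hx hW) this

open Classical in
/-- The coefficient of `τ` in the differential of `σ`. -/
def cechCoeff (o : Δ.Orientations) (σ τ : Δ.Face) : ℤ :=
  if τ.carrier ⊆ σ.carrier then incidence o σ τ else 0

theorem toSet_subset_toSet {σ τ : Δ.Face} : τ.toSet ⊆ σ.toSet ↔ τ.carrier ⊆ σ.carrier :=
  ⟨fun h x hx => @h ⟨x, τ.isExposed.subset hx⟩ hx, fun h _ hx => h hx⟩

-- Decomposing `s` into its components makes the differential a matrix product at each point; this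
-- is the bridge from sheaves to integer matrices.
open Classical in
theorem cechEval_cechD (o : Δ.Orientations) {p : ℕ} [Fintype (Δ.FacesOfCodim p)]
    (U : Opens Δ.space)
    (τ : Δ.FacesOfCodim (p + 1)) (x : Δ.space) (hx : x ∈ τ.1.toSet) (hU : x ∈ U)
    (s : Sections (Δ.cechX p) U) :
    cechEval U τ x hx hU (onSections _ _ U (cechD o p) s) =
      ∑ σ : Δ.FacesOfCodim p, if h : x ∈ σ.1.toSet then
        cechCoeff o σ.1 τ.1 * cechEval U σ x h hU s else 0 := by
  conv_lhs => rw [← sum_onSections_ι_π U s]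
  rw [map_sum, map_sum]
  refine Finset.sum_congr rfl fun σ _ => ?_
  set s' := onSections _ _ U (cechπ σ) s with hs'
  have h2 : cechEval U τ x hx hU (onSections _ _ U (cechD o p) (onSections _ _ U (cechι σ) s')) =
      pointEval τ.1.toSet U x hx hU
        (onSections _ _ U (cechι σ ≫ cechD o p ≫ cechπ τ) s') := rfl
  refine h2.trans ?_
  rw [cechι_d_π]
  by_cases h : τ.1.toSet ⊆ σ.1.toSet
  · rw [dif_pos h, dif_pos (h hx), cechCoeff, if_pos (toSet_subset_toSet.1 h), map_zsmul,
      AddMonoidHom.smul_apply, map_zsmul, smul_eq_mul]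
    rfl
  · rw [dif_neg h, cechCoeff, if_neg (fun h' => h (toSet_subset_toSet.2 h'))]
    simp

theorem exists_cechEval_eq {p : ℕ} (U : Opens Δ.space)
    (t : ∀ σ : Δ.FacesOfCodim p, Sections (constOn σ.1.toSet) U) :
    ∃ s : Sections (Δ.cechX p) U, ∀ σ x hx hU, cechEval U σ x hx hU s =
      pointEval σ.1.toSet U x hx hU (t σ) := by
  classical
  have := Fintype.ofFinite (Δ.FacesOfCodim p)
  refine ⟨∑ σ, onSections _ _ U
    (cechι σ) (t σ),
    fun σ x hx hU => ?_⟩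
  rw [map_sum, Finset.sum_eq_single σ]
  · change pointEval σ.1.toSet U x hx hU (onSections _ _ U (cechι σ ≫ cechπ σ) (t σ)) = _
    rw [cechι_π_self]
    rfl
  · intro σ' _ hne
    change pointEval σ.1.toSet U x hx hU (onSections _ _ U (cechι σ' ≫ cechπ σ) (t σ')) = _
    rw [cechι_π_ne hne]
    simp
  · simp

theorem cechEval_cechAug (U : Opens Δ.space) (σ : Δ.FacesOfCodim 0) (x : Δ.space)
    (hx : x ∈ σ.1.toSet) (hU : x ∈ U) (s : Sections (extByZero Δ.interiorSet) U) :
    cechEval U σ x hx hU (onSections _ _ U Δ.cechAug s) =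
      zeroExt Δ.isOpen_interiorSet U s ⟨x, hU⟩ := by
  change pointEval σ.1.toSet U x hx hU (onSections _ _ U (Δ.cechAug ≫ cechπ σ) s) = _
  rw [cechAug_π]
  rfl

end Polyhedron
end CechPoly

/-! ### Acyclicity of finite complexes indexed by a poset. -/

namespace CechPoly

section Acyclic

variable {S : Type*} [Fintype S]

/-- The subquotient supported on `K` of the complex with basis `S` and boundary matrix `d`
is acyclic. -/
def IsAcyclicOn (d : S → S → ℤ) (K : Set S) : Prop :=
  ∀ z : S → ℤ, (∀ σ ∉ K, z σ = 0) → (∀ τ ∈ K, ∑ σ, z σ * d σ τ = 0) →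
    ∃ y : S → ℤ, (∀ σ ∉ K, y σ = 0) ∧ ∀ τ ∈ K, ∑ σ, y σ * d σ τ = z τ

theorem isAcyclicOn_pair {d : S → S → ℤ} {σ ρ : S} (hne : σ ≠ ρ) (hσρ : d σ ρ = 1 ∨ d σ ρ = -1)
    (h1 : d σ σ = 0) (h2 : d ρ ρ = 0) (h3 : d ρ σ = 0) : IsAcyclicOn d {σ, ρ} := by
  classical
  have hsum : ∀ z : S → ℤ, (∀ τ ∉ ({σ, ρ} : Set S), z τ = 0) → ∀ τ,
      ∑ π, z π * d π τ = z σ * d σ τ + z ρ * d ρ τ := by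
    intro z hz τ
    rw [← Finset.sum_pair (f := fun π => z π * d π τ) hne]
    refine (Finset.sum_subset (Finset.subset_univ _) fun π _ hπ => ?_).symm
    rw [hz π (by simpa using hπ), zero_mul]
  intro z hz hdz
  have hzσ : z σ = 0 := by
    have := hdz ρ (by simp)
    rw [hsum z hz, h2, mul_zero, add_zero] at this
    rcases hσρ with h | h <;> rw [h] at this <;> linarith
  have hs : ∀ τ ∉ ({σ, ρ} : Set S), (if τ = σ then d σ ρ * z ρ else 0) = 0 := by
    intro τ hτ
    rw [if_neg]
    rintro rfl
    exact hτ (by simp)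
  -- The coefficient is ±1, hence its own inverse.
  refine ⟨fun τ => if τ = σ then d σ ρ * z ρ else 0, hs, fun τ hτ => ?_⟩
  rw [hsum _ hs, if_pos rfl, if_neg hne.symm, zero_mul, add_zero]
  rcases hτ with rfl | hτ
  · rw [h1, hzσ, mul_zero]
  · rw [Set.mem_singleton_iff.1 hτ]
    rcases hσρ with h | h <;> rw [h] <;> ring

variable [PartialOrder S] {d : S → S → ℤ}

/-- Truncating to `K` preserves `d² = 0`: nonzero entries go downwards and `K` is order-convex, so a
path of two entries with both ends in `K` has its middle in `K`. -/
theorem sum_sum_mul_eq_zero (hd : ∀ σ τ, d σ τ ≠ 0 → τ ≤ σ)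
    (hdd : ∀ σ ρ, ∑ τ, d σ τ * d τ ρ = 0) {K : Set S} (hK : K.OrdConnected)
    {y w : S → ℤ} (hy : ∀ σ ∉ K, y σ = 0) (hw : ∀ σ ∉ K, w σ = 0)
    (hyw : ∀ τ ∈ K, ∑ σ, y σ * d σ τ = w τ) {ρ : S} (hρ : ρ ∈ K) :
    ∑ τ, w τ * d τ ρ = 0 := by
  have h1 : ∀ τ, w τ * d τ ρ = ∑ σ, y σ * (d σ τ * d τ ρ) := by
    intro τ
    by_cases hτ : τ ∈ K
    · rw [← hyw τ hτ, Finset.sum_mul]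
      exact Finset.sum_congr rfl fun _ _ => mul_assoc _ _ _
    · rw [hw τ hτ, zero_mul]
      refine (Finset.sum_eq_zero fun σ _ => ?_).symm
      by_cases hσ : σ ∈ K
      · by_contra hne
        simp only [mul_eq_zero, not_or] at hne
        exact hτ (hK.out hρ hσ ⟨hd _ _ hne.2.2, hd _ _ hne.2.1⟩)
      · rw [hy σ hσ, zero_mul]
  simp only [h1]
  rw [Finset.sum_comm]
  refine Finset.sum_eq_zero fun σ _ => ?_
  rw [← Finset.mul_sum, hdd, mul_zero]

/-- No entry leads from `D` into `E`, so `D` spans a subcomplex with quotient `E`. A cycle is first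
bounded in the quotient; subtracting the boundary of that primitive leaves a cycle in `D`. -/
theorem IsAcyclicOn.union (hd : ∀ σ τ, d σ τ ≠ 0 → τ ≤ σ)
    (hdd : ∀ σ ρ, ∑ τ, d σ τ * d τ ρ = 0) {D E : Set S} (hK : (D ∪ E).OrdConnected)
    (h0 : ∀ σ ∈ D, ∀ τ ∈ E, d σ τ = 0)
    (hD : IsAcyclicOn d D) (hE : IsAcyclicOn d E) : IsAcyclicOn d (D ∪ E) := by
  classical
  intro z hz hdz
  obtain ⟨y, hy, hyz⟩ := hE (fun σ => if σ ∈ E then z σ else 0) (fun σ hσ => if_neg hσ) (by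
    intro τ hτ
    refine Eq.trans ?_ (hdz τ (Or.inr hτ))
    refine Finset.sum_congr rfl fun σ _ => ?_
    split_ifs with hσ
    · rfl
    · rw [zero_mul]
      by_cases hσD : σ ∈ D
      · rw [h0 σ hσD τ hτ, mul_zero]
      · rw [hz σ (fun h => h.elim hσD hσ), zero_mul])
  have hyK : ∀ σ ∉ D ∪ E, y σ = 0 := fun σ hσ => hy σ fun h => hσ (Or.inr h)
  -- The full boundary of `y` inside `D ∪ E`, including its part in `D`; it agrees with `z` on `E`.
  let w : S → ℤ := fun τ => if τ ∈ D ∪ E then ∑ σ, y σ * d σ τ else 0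
  have hw : ∀ τ ∈ D, ∑ σ, w σ * d σ τ = 0 := fun τ hτ =>
    sum_sum_mul_eq_zero hd hdd hK hyK (fun σ hσ => if_neg hσ)
      (fun τ hτ => (if_pos hτ).symm) (Or.inl hτ)
  have hzw : ∀ σ ∉ D, z σ - w σ = 0 := by
    intro σ hσ
    by_cases hσE : σ ∈ E
    · have h1 : w σ = ∑ ρ, y ρ * d ρ σ := if_pos (Or.inr hσE)
      rw [h1, hyz σ hσE, if_pos hσE, sub_self]
    · have : σ ∉ D ∪ E := fun h => h.elim hσ hσE
      rw [hz σ this, show w σ = 0 from if_neg this, sub_self]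
  obtain ⟨y', hy', hyz'⟩ := hD (fun σ => z σ - w σ) hzw (by
    intro τ hτ
    simp only [sub_mul, Finset.sum_sub_distrib]
    rw [hw τ hτ, hdz τ (Or.inl hτ), sub_zero])
  refine ⟨fun σ => y σ + y' σ, fun σ hσ => ?_, fun τ hτ => ?_⟩
  · change y σ + y' σ = 0
    rw [hyK σ hσ, hy' σ fun h => hσ (Or.inl h), add_zero]
  · simp only [add_mul, Finset.sum_add_distrib]
    rcases hτ with hτ | hτ
    · rw [hyz' τ hτ, show w τ = _ from if_pos (Or.inl hτ)]
      ring
    · rw [hyz τ hτ, if_pos hτ, Finset.sum_eq_zero, add_zero]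
      intro σ _
      by_cases hσ : σ ∈ D
      · rw [h0 σ hσ τ hτ, mul_zero]
      · rw [hy' σ hσ, zero_mul]

/-- Split off the fibre over a maximal value of `m`. Entries go downwards and `m` is monotone, so no
entry leads into this fibre from outside, and `IsAcyclicOn.union` applies. -/
theorem IsAcyclicOn.of_fibers (hd : ∀ σ τ, d σ τ ≠ 0 → τ ≤ σ)
    (hdd : ∀ σ ρ, ∑ τ, d σ τ * d τ ρ = 0) {P : Type*} [PartialOrder P] {m : S → P} {K : Set S}
    (hK : K.OrdConnected) (hm : MonotoneOn m K)
    (h : ∀ σ ∈ K, IsAcyclicOn d {τ ∈ K | m τ = m σ}) : IsAcyclicOn d K := by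
  induction hn : K.ncard using Nat.strong_induction_on generalizing K with
  | _ n ih =>
  rcases K.eq_empty_or_nonempty with rfl | hne
  · exact fun z hz _ => ⟨0, fun _ _ => rfl, fun τ hτ => hτ.elim⟩
  obtain ⟨p, ⟨σ, hσ, rfl⟩, hmax⟩ := (K.toFinite.image m).exists_maximal (hne.image m)
  replace hmax : ∀ τ ∈ K, m σ ≤ m τ → m τ = m σ := fun τ hτ hle =>
    (hmax ⟨τ, hτ, rfl⟩ hle).antisymm hle
  have hu : {τ ∈ K | m τ ≠ m σ} ∪ {τ ∈ K | m τ = m σ} = K := by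
    ext τ; by_cases h : m τ = m σ <;> simp [h]
  have hlt : {τ ∈ K | m τ ≠ m σ}.ncard < n := by
    rw [← hn]
    exact Set.ncard_lt_ncard ⟨fun τ hτ => hτ.1, fun hsub => (hsub hσ).2 rfl⟩ K.toFinite
  have hD : IsAcyclicOn d {τ ∈ K | m τ ≠ m σ} := by
    refine ih _ hlt ⟨fun x hx y hy z hz => ?_⟩ (hm.mono fun τ hτ => hτ.1) (fun τ hτ => ?_) rfl
    · have hzK := hK.out hx.1 hy.1 hz
      exact ⟨hzK, fun he => hy.2 (hmax y hy.1 (he ▸ hm hzK hy.1 hz.2))⟩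
    · convert h τ hτ.1 using 2
      ext ρ
      simp only [Set.mem_ofPred_eq, and_assoc]
      exact and_congr_right fun _ => ⟨fun h => h.2, fun h => ⟨h ▸ hτ.2, h⟩⟩
  rw [← hu]
  refine IsAcyclicOn.union hd hdd (by rwa [hu]) ?_ hD (h σ hσ)
  · intro ρ hρ τ hτ
    by_contra hne
    exact hρ.2 (hmax ρ hρ.1 (hτ.2 ▸ hm hτ.1 hρ.1 (hd _ _ hne)))

end Acyclic

end CechPoly

/-! ### Convex geometry of systems of linear inequalities. -/

namespace CechPoly

section PolyhedralSets

open Module Filter Topology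

variable {V : Type u} [AddCommGroup V] [Module ℝ V]

/-- The set of solutions of a finite family of affine-linear inequalities. -/
def solutionSet (I : Finset (Dual ℝ V × ℝ)) : Set V := {x | ∀ p ∈ I, p.1 x ≤ p.2}

theorem convex_solutionSet (I : Finset (Dual ℝ V × ℝ)) : Convex ℝ (solutionSet I) := by
  intro x hx y hy a b ha hb hab p hp
  have h1 := mul_le_mul_of_nonneg_left (hx p hp) ha
  have h2 := mul_le_mul_of_nonneg_left (hy p hp) hb
  simp only [map_add, map_smul, smul_eq_mul]
  have h3 : p.2 = a * p.2 + b * p.2 := by rw [← add_mul, hab, one_mul]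
  linarith

/-- A nonempty convex subset of a polyhedron contains a point at which all the inequalities which
are not equalities on this subset are strict. -/
theorem exists_strict_of_convex {I : Finset (Dual ℝ V × ℝ)} {Q : Set V} (hQ : Convex ℝ Q)
    (hne : Q.Nonempty) (hQI : Q ⊆ solutionSet I) :
    ∃ z ∈ Q, ∀ p ∈ I, (∀ x ∈ Q, p.1 x = p.2) ∨ p.1 z < p.2 := by
  classical
  suffices ∀ J ⊆ I, ∃ z ∈ Q, ∀ p ∈ J, (∀ x ∈ Q, p.1 x = p.2) ∨ p.1 z < p.2 from
    this I subset_rfl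
  intro J
  induction J using Finset.induction_on with
  | empty => exact fun _ => ⟨hne.some, hne.some_mem, by simp⟩
  | insert q J _ ih =>
    intro hJ
    obtain ⟨z, hz, hzJ⟩ := ih fun p hp => hJ (Finset.mem_insert_of_mem hp)
    by_cases hq : ∀ x ∈ Q, q.1 x = q.2
    · exact ⟨z, hz, fun p hp => (Finset.mem_insert.1 hp).elim (fun h => .inl (h ▸ hq)) (hzJ p)⟩
    · push Not at hq
      obtain ⟨y, hy, hyq⟩ := hq
      refine ⟨(1 / 2 : ℝ) • z + (1 / 2 : ℝ) • y,
        hQ hz hy (by norm_num) (by norm_num) (by norm_num), fun p hp => ?_⟩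
      have h1 := hQI hz p (hJ hp)
      have h2 := hQI hy p (hJ hp)
      simp only [map_add, map_smul, smul_eq_mul]
      rcases Finset.mem_insert.1 hp with rfl | hp
      · exact .inr (by linarith [lt_of_le_of_ne h2 hyq])
      · exact (hzJ p hp).imp_right fun h => by linarith

/-- A strict inequality survives a small step in any direction, and the others do not increase along
`v`; finitely many conditions have a common step size. -/
theorem exists_pos_add_smul_mem {I : Finset (Dual ℝ V × ℝ)} {z v : V}
    (h : ∀ p ∈ I, p.1 z < p.2 ∨ p.1 z ≤ p.2 ∧ p.1 v ≤ 0) :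
    ∃ t : ℝ, 0 < t ∧ z + t • v ∈ solutionSet I := by
  have key : ∀ᶠ t : ℝ in 𝓝[>] 0, ∀ p ∈ I, p.1 (z + t • v) ≤ p.2 := by
    rw [Filter.eventually_all_finset]
    intro p hp
    simp only [map_add, map_smul, smul_eq_mul]
    rcases h p hp with h | ⟨h1, h2⟩
    · have hc : Tendsto (fun t : ℝ => p.1 z + t * p.1 v) (𝓝 0) (𝓝 (p.1 z + 0 * p.1 v)) :=
        Continuous.tendsto (by fun_prop) 0
      rw [zero_mul, add_zero] at hc
      exact ((hc.eventually (gt_mem_nhds h)).filter_mono nhdsWithin_le_nhds).mono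
        fun t ht => ht.le
    · filter_upwards [self_mem_nhdsWithin] with t ht
      have : t * p.1 v ≤ 0 := mul_nonpos_of_nonneg_of_nonpos (le_of_lt ht) h2
      linarith
  obtain ⟨t, ht, ht0⟩ := (key.and self_mem_nhdsWithin).exists
  exact ⟨t, ht0, ht⟩

theorem convex_face {P : Set V} (hP : Convex ℝ P) (h : Dual ℝ V) (c : ℝ) :
    Convex ℝ {x ∈ P | h x = c} := by
  intro x hx y hy a b ha hb hab
  refine ⟨hP hx.1 hy.1 ha hb hab, ?_⟩
  simp only [map_add, map_smul, smul_eq_mul]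
  rw [hx.2, hy.2, ← add_mul, hab, one_mul]

/-- The segment from `x` to a relatively interior point `z` of the face can be prolonged a little
beyond `z`. Along it the affine function `h` takes its minimum `c` at an inner point, so it is
constant. -/
theorem mem_face_of_tight {I : Finset (Dual ℝ V × ℝ)} {h : Dual ℝ V} {c : ℝ}
    (hc : ∀ x ∈ solutionSet I, c ≤ h x) (hne : {x ∈ solutionSet I | h x = c}.Nonempty)
    {x : V} (hx : x ∈ solutionSet I)
    (ht : ∀ p ∈ I, (∀ y ∈ {x ∈ solutionSet I | h x = c}, p.1 y = p.2) → p.1 x = p.2) :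
    h x = c := by
  obtain ⟨z, hz, hzI⟩ := exists_strict_of_convex (convex_face (convex_solutionSet I) h c) hne
    (fun _ hx => hx.1)
  obtain ⟨t, ht0, htI⟩ := exists_pos_add_smul_mem (I := I) (z := z) (v := z - x) fun p hp => by
    refine (hzI p hp).symm.imp_right fun h => ⟨(h z hz).le, ?_⟩
    rw [map_sub, h z hz, ht p hp h, sub_self]
  have h1 := hc _ htI
  simp only [map_add, map_smul, map_sub, smul_eq_mul, hz.2] at h1
  have h2 : 0 ≤ t * (c - h x) := by linarith
  have h3 := nonneg_of_mul_nonneg_right h2 ht0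
  linarith [hc x hx]

/-- A sum of inequalities is an equality only if every one of them is. -/
theorem exists_functional_of_tight (I J : Finset (Dual ℝ V × ℝ)) (hJ : J ⊆ I) :
    ∃ (h : Dual ℝ V) (c : ℝ), (∀ x ∈ solutionSet I, c ≤ h x) ∧
      ∀ x ∈ solutionSet I, h x = c ↔ ∀ p ∈ J, p.1 x = p.2 := by
  refine ⟨-∑ p ∈ J, p.1, -∑ p ∈ J, p.2, fun x hx => ?_, fun x hx => ?_⟩
  · rw [LinearMap.neg_apply, LinearMap.sum_apply]
    exact neg_le_neg (Finset.sum_le_sum fun p hp => hx p (hJ hp))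
  · rw [LinearMap.neg_apply, LinearMap.sum_apply, neg_inj]
    exact Finset.sum_eq_sum_iff_of_le fun p hp => hx p (hJ hp)

/-- A face of a face of a polyhedron is a face of the polyhedron. -/
theorem exists_functional_face_trans {I : Finset (Dual ℝ V × ℝ)} {h g : Dual ℝ V} {c e : ℝ}
    (hc : ∀ x ∈ solutionSet I, c ≤ h x)
    (he : ∀ x ∈ solutionSet I, h x = c → e ≤ g x)
    (hne : ∃ x ∈ solutionSet I, h x = c ∧ g x = e) :
    ∃ (k : Dual ℝ V) (a : ℝ), (∀ x ∈ solutionSet I, a ≤ k x) ∧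
      ∀ x ∈ solutionSet I, k x = a ↔ h x = c ∧ g x = e := by
  classical
  obtain ⟨x₀, hx₀, hx₀h, hx₀g⟩ := hne
  obtain ⟨k, a, hk, hka⟩ := exists_functional_of_tight I
    (I.filter fun p => ∀ y ∈ solutionSet I, h y = c → g y = e → p.1 y = p.2)
    (Finset.filter_subset _ _)
  refine ⟨k, a, hk, fun x hx => ?_⟩
  rw [hka x hx]
  simp only [Finset.mem_filter, and_imp]
  refine ⟨fun ht => ?_, fun hxg p hp htp => htp x hx hxg.1 hxg.2⟩
  have hxc : h x = c := mem_face_of_tight hc ⟨x₀, hx₀, hx₀h⟩ hx fun p hp hp' =>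
    ht p hp fun y hy hyh _ => hp' y ⟨hy, hyh⟩
  refine ⟨hxc, ?_⟩
  -- Adding `h ≤ c` presents the first face as a polyhedron, so the tightness criterion can be used
  -- a second time, inside it.
  have hmem : ∀ y, y ∈ solutionSet (insert (h, c) I) ↔ y ∈ solutionSet I ∧ h y = c := by
    intro y
    simp only [solutionSet, Finset.forall_mem_insert, Set.mem_ofPred_eq]
    exact ⟨fun hy => ⟨hy.2, hy.1.antisymm (hc y hy.2)⟩, fun hy => ⟨hy.2.le, hy.1⟩⟩
  refine mem_face_of_tight (I := insert (h, c) I)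
    (fun y hy => he y ((hmem y).1 hy).1 ((hmem y).1 hy).2)
    ⟨x₀, (hmem x₀).2 ⟨hx₀, hx₀h⟩, hx₀g⟩ ((hmem x).2 ⟨hx, hxc⟩) fun p hp hp' => ?_
  rcases Finset.mem_insert.1 hp with rfl | hp
  · exact hxc
  · exact ht p hp fun y hy hyh hyg => hp' y ⟨(hmem y).2 ⟨hy, hyh⟩, hyg⟩

/-- If `G` is the face of a polyhedron `P` on which `h` attains its minimum `c`,
and if `g` is constant on `G`, then the ratio of `g` and `h` (with constants chosen such that both
vanish on `G`) attains its maximum on `P \ G`. -/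
theorem exists_max_ratio [FiniteDimensional ℝ V] {I : Finset (Dual ℝ V × ℝ)} {h g : Dual ℝ V}
    {c e : ℝ} (hc : ∀ x ∈ solutionSet I, c ≤ h x) (hne : ∃ x ∈ solutionSet I, h x = c)
    (hne' : ∃ x ∈ solutionSet I, h x ≠ c) (hg : ∀ x ∈ solutionSet I, h x = c → g x = e) :
    ∃ s : ℝ, (∀ x ∈ solutionSet I, g x - e ≤ s * (h x - c)) ∧
      ∃ y ∈ solutionSet I, h y ≠ c ∧ g y - e = s * (h y - c) := by
  classical
  obtain ⟨z, hz, hzI⟩ := exists_strict_of_convex (convex_face (convex_solutionSet I) h c) hne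
    (fun _ hx => hx.1)
  have hge := hg z hz.1 hz.2
  let J := I.filter fun p => ∀ x ∈ {x ∈ solutionSet I | h x = c}, p.1 x = p.2
  have hJ : ∀ {p}, p ∈ J ↔ p ∈ I ∧ ∀ x ∈ {x ∈ solutionSet I | h x = c}, p.1 x = p.2 :=
    Finset.mem_filter
  -- `C` is the cone of feasible directions at `z`, and its lineality space `L` is the direction of
  -- the face. Both `h` and `g` vanish on `L`, and `h` is positive on the rest of `C`. On a
  -- complement `W` of `L` the ratio is therefore homogeneous of degree 0 and continuous on the
  -- compact set of unit vectors of `C ∩ W`.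
  let C : Set V := {v | ∀ p ∈ J, p.1 v ≤ 0}
  have hCP : ∀ v ∈ C, ∃ t : ℝ, 0 < t ∧ z + t • v ∈ solutionSet I := fun v hv =>
    exists_pos_add_smul_mem fun p hp => (hzI p hp).symm.imp_right fun h' =>
      ⟨hz.1 p hp, hv p (hJ.2 ⟨hp, h'⟩)⟩
  have hPC : ∀ x ∈ solutionSet I, x - z ∈ C := fun x hx p hp => by
    rw [map_sub, (hJ.1 hp).2 z hz]
    linarith [hx p (hJ.1 hp).1]
  have hC0 : ∀ v ∈ C, 0 ≤ h v := fun v hv => by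
    obtain ⟨t, ht, hvt⟩ := hCP v hv
    have := hc _ hvt
    rw [map_add, map_smul, hz.2, smul_eq_mul] at this
    exact nonneg_of_mul_nonneg_right (by linarith : 0 ≤ t * h v) ht
  let L : Submodule ℝ V := ⨅ p ∈ J, LinearMap.ker p.1
  have hL : ∀ {v}, v ∈ L ↔ ∀ p ∈ J, p.1 v = 0 := by simp [L]
  have hCL : ∀ v ∈ C, h v = 0 → v ∈ L := fun v hv hv0 => by
    obtain ⟨t, ht, hvt⟩ := hCP v hv
    refine hL.2 fun p hp => ?_
    have h1 := (hJ.1 hp).2 (z + t • v) ⟨hvt, by simp [hv0, hz.2]⟩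
    rw [map_add, (hJ.1 hp).2 z hz, map_smul, smul_eq_mul, add_eq_left, mul_eq_zero] at h1
    exact h1.resolve_left ht.ne'
  have hLC : ∀ v ∈ L, v ∈ C := fun v hv p hp => (hL.1 hv p hp).le
  have hLh : ∀ v ∈ L, h v = 0 := fun v hv => by
    have h1 := hC0 v (hLC v hv)
    have h2 := hC0 (-v) (hLC _ (L.neg_mem hv))
    rw [map_neg] at h2
    linarith
  have hLg : ∀ v ∈ L, g v = 0 := fun v hv => by
    obtain ⟨t, ht, hvt⟩ := hCP v (hLC v hv)
    have h1 := hg _ hvt (by simp [hLh v hv, hz.2])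
    rw [map_add, hge, map_smul, smul_eq_mul, add_eq_left, mul_eq_zero] at h1
    exact h1.resolve_left ht.ne'
  obtain ⟨W, hW⟩ := L.exists_isCompl
  have hdec : ∀ v ∈ C, ∃ w ∈ W, w ∈ C ∧ h w = h v ∧ g w = g v := by
    intro v hv
    obtain ⟨l, hl, w, hw, rfl⟩ := Submodule.mem_sup.1
      (show v ∈ L ⊔ W by rw [hW.sup_eq_top]; trivial)
    refine ⟨w, hw, fun p hp => ?_, ?_, ?_⟩
    · have := hv p hp
      rwa [map_add, hL.1 hl p hp, zero_add] at this
    · rw [map_add, hLh l hl, zero_add]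
    · rw [map_add, hLg l hl, zero_add]
  let b := Module.finBasis ℝ V
  let φ : V ≃ₗ[ℝ] EuclideanSpace ℝ (Fin (finrank ℝ V)) :=
    b.equivFun.trans (WithLp.linearEquiv 2 ℝ _).symm
  let S : Set (EuclideanSpace ℝ (Fin (finrank ℝ V))) :=
    {a | ‖a‖ = 1 ∧ φ.symm a ∈ W ∧ φ.symm a ∈ C}
  have hcont : ∀ f : Dual ℝ V, Continuous fun a => f (φ.symm a) := fun f =>
    (f.comp φ.symm.toLinearMap).continuous_of_finiteDimensional
  have hScomp : IsCompact S := by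
    refine (isCompact_sphere (0 : EuclideanSpace ℝ (Fin (finrank ℝ V))) 1).of_isClosed_subset ?_
      fun a ha => by simpa using ha.1
    refine (isClosed_eq continuous_norm continuous_const).inter (IsClosed.inter ?_ ?_)
    · exact (W.comap φ.symm.toLinearMap).closed_of_finiteDimensional
    · have : {a | φ.symm a ∈ C} = ⋂ p ∈ J, {a | p.1 (φ.symm a) ≤ 0} := by
        ext a; simp [C]
      change IsClosed {a | φ.symm a ∈ C}
      rw [this]
      exact isClosed_biInter fun p _ => isClosed_le (hcont p.1) continuous_const
  have hS : ∀ w ∈ W, w ∈ C → w ≠ 0 → ‖φ w‖⁻¹ • φ w ∈ S := by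
    intro w hw hwC hw0
    have hn : ‖φ w‖ ≠ 0 := by simpa using hw0
    refine ⟨by rw [norm_smul, norm_inv, norm_norm, inv_mul_cancel₀ hn], ?_, ?_⟩
    · rw [map_smul, φ.symm_apply_apply]; exact W.smul_mem _ hw
    · rw [map_smul, φ.symm_apply_apply]
      intro p hp
      rw [map_smul, smul_eq_mul]
      exact mul_nonpos_of_nonneg_of_nonpos (by positivity) (hwC p hp)
  have hSpos : ∀ a ∈ S, 0 < h (φ.symm a) := by
    intro a ha
    refine lt_of_le_of_ne (hC0 _ ha.2.2) fun h0 => ?_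
    have h1 : φ.symm a = 0 := (Submodule.disjoint_def.1 hW.disjoint) _ (hCL _ ha.2.2 h0.symm) ha.2.1
    have h2 : a = 0 := by simpa using h1
    simpa [h2] using ha.1
  have hSne : S.Nonempty := by
    obtain ⟨x, hx, hxc⟩ := hne'
    obtain ⟨w, hw, hwC, hwh, -⟩ := hdec _ (hPC x hx)
    refine ⟨_, hS w hw hwC ?_⟩
    rintro rfl
    rw [map_zero, map_sub, hz.2] at hwh
    exact hxc (by linarith)
  obtain ⟨a, ha, hmax⟩ := hScomp.exists_isMaxOn hSne
    (f := fun a => g (φ.symm a) / h (φ.symm a))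
    ((hcont g).continuousOn.div (hcont h).continuousOn fun a ha => (hSpos a ha).ne')
  refine ⟨g (φ.symm a) / h (φ.symm a), fun x hx => ?_, ?_⟩
  · obtain ⟨w, hw, hwC, hwh, hwg⟩ := hdec _ (hPC x hx)
    rw [map_sub, hz.2] at hwh
    rw [map_sub, hge] at hwg
    rw [← hwh, ← hwg]
    rcases eq_or_ne w 0 with rfl | hw0
    · simp
    · have h1 := hmax (hS w hw hwC hw0)
      have h2 := hSpos _ (hS w hw hwC hw0)
      have hn : 0 < ‖φ w‖⁻¹ := by simpa using hw0
      simp only [Set.mem_ofPred_eq, map_smul, φ.symm_apply_apply, smul_eq_mul] at h1 h2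
      rw [mul_div_mul_left _ _ hn.ne'] at h1
      exact (div_le_iff₀ (pos_of_mul_pos_right h2 hn.le)).1 h1
  -- The maximising direction, scaled down, is realised by a point of the polyhedron.
  · obtain ⟨t, ht, hvt⟩ := hCP _ ha.2.2
    have hpos := hSpos a ha
    refine ⟨_, hvt, ?_, ?_⟩
    · rw [map_add, map_smul, hz.2, smul_eq_mul]
      have := mul_pos ht hpos
      linarith
    · simp only [map_add, map_smul, hz.2, hge, smul_eq_mul]
      field_simp
      ring

end PolyhedralSets

end CechPoly

/-! ### The face poset of a polyhedron. -/

namespace CechPoly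
namespace Polyhedron

open Module

variable {V : Type u} [AddCommGroup V] [Module ℝ V] [TopologicalSpace V] {Δ : Polyhedron V}

instance : PartialOrder Δ.Face :=
  PartialOrder.lift Face.carrier fun _ _ => Face.ext_carrier

namespace Face

theorem subset_carrier (σ : Δ.Face) : σ.carrier ⊆ Δ.carrier := σ.isExposed.subset

theorem exists_functional (σ : Δ.Face) : ∃ (h : Dual ℝ V) (c : ℝ),
    (∀ x ∈ Δ.carrier, c ≤ h x) ∧ ∀ x ∈ Δ.carrier, h x = c ↔ x ∈ σ.carrier := by
  obtain ⟨l, hl⟩ := σ.isExposed σ.nonempty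
  obtain ⟨z, hz⟩ := σ.nonempty
  have hz' := hz
  rw [hl] at hz'
  refine ⟨-l.toLinearMap, -l z, fun x hx => neg_le_neg (hz'.2 x hx), fun x hx => ?_⟩
  rw [hl]
  change -l x = -l z ↔ _
  rw [neg_inj]
  exact ⟨fun h => ⟨hx, fun y hy => h ▸ hz'.2 y hy⟩, fun h => (hz'.2 x hx).antisymm (h.2 z hz'.1)⟩

theorem exists_solutionSet (σ : Δ.Face) : ∃ I, σ.carrier = solutionSet I := by
  classical
  obtain ⟨I, hI⟩ := Δ.exists_finset
  obtain ⟨h, c, hc, hσ⟩ := σ.exists_functional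
  refine ⟨insert (h, c) I, ?_⟩
  ext x
  simp only [solutionSet, Finset.forall_mem_insert, Set.mem_ofPred_eq]
  have hx : x ∈ Δ.carrier ↔ ∀ p ∈ I, p.1 x ≤ p.2 := by rw [hI]; rfl
  rw [← hx]
  exact ⟨fun h' => ⟨((hσ x (σ.subset_carrier h')).2 h').le, σ.subset_carrier h'⟩,
    fun h' => (hσ x h'.2).1 (h'.1.antisymm (hc x h'.2))⟩

theorem convex (σ : Δ.Face) : Convex ℝ σ.carrier := by
  obtain ⟨I, hI⟩ := σ.exists_solutionSet
  rw [hI]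
  exact convex_solutionSet I

theorem functional_eq_on_direction {σ : Δ.Face} {h g : Dual ℝ V}
    (H : ∀ x ∈ σ.carrier, ∀ y ∈ σ.carrier, h x - h y = g x - g y) {v : V} (hv : v ∈ σ.direction) :
    h v = g v := by
  have : σ.direction ≤ LinearMap.ker (h - g) := by
    rw [direction, vectorSpan, Submodule.span_le]
    rintro _ ⟨x, hx, y, hy, rfl⟩
    have := H x hx y hy
    simp only [vsub_eq_sub, SetLike.mem_coe, LinearMap.mem_ker, LinearMap.sub_apply, map_sub]
    linarith
  exact sub_eq_zero.1 (this hv)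

theorem sub_mem_direction {σ : Δ.Face} {x y : V} (hx : x ∈ σ.carrier) (hy : y ∈ σ.carrier) :
    x - y ∈ σ.direction := vsub_mem_vectorSpan ℝ hx hy

theorem direction_mono {σ τ : Δ.Face} (h : σ ≤ τ) : σ.direction ≤ τ.direction :=
  vectorSpan_mono ℝ h

theorem eq_zero_on_direction {σ : Δ.Face} {h : Dual ℝ V} {c : ℝ}
    (H : ∀ x ∈ σ.carrier, h x = c) {v : V} (hv : v ∈ σ.direction) : h v = 0 :=
  functional_eq_on_direction (g := 0) (fun x hx y hy => by rw [H x hx, H y hy]; simp) hv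

/-- A functional exposing `σ` vanishes on its direction. Hence a face is determined by its affine
span, and dimension is strictly increasing on faces. -/
theorem mem_of_sub_mem_direction {σ : Δ.Face} {x y : V} (hx : x ∈ Δ.carrier) (hy : y ∈ σ.carrier)
    (h : x - y ∈ σ.direction) : x ∈ σ.carrier := by
  obtain ⟨k, c, -, hk⟩ := σ.exists_functional
  have h1 := eq_zero_on_direction (fun x hx => (hk x (σ.subset_carrier hx)).2 hx) h
  rw [map_sub, (hk y (σ.subset_carrier hy)).2 hy] at h1
  exact (hk x hx).1 (by linarith)

theorem exists_mem_notMem_of_lt {σ τ : Δ.Face} (h : σ < τ) : ∃ x ∈ τ.carrier, x ∉ σ.carrier :=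
  Set.exists_of_ssubset h

variable [FiniteDimensional ℝ V]

theorem dim_lt_dim {σ τ : Δ.Face} (h : σ < τ) : σ.dim < τ.dim := by
  refine Submodule.finrank_lt_finrank_of_lt (lt_of_le_of_ne (direction_mono h.le) fun he => ?_)
  obtain ⟨x, hx, hxσ⟩ := exists_mem_notMem_of_lt h
  obtain ⟨y, hy⟩ := σ.nonempty
  exact hxσ (mem_of_sub_mem_direction (τ.subset_carrier hx) hy
    (he ▸ sub_mem_direction hx (h.le hy)))

theorem dim_le_dim {σ τ : Δ.Face} (h : σ ≤ τ) : σ.dim ≤ τ.dim :=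
  Submodule.finrank_mono (direction_mono h)

theorem eq_of_le_of_dim_le {σ τ : Δ.Face} (h : σ ≤ τ) (hd : τ.dim ≤ σ.dim) : σ = τ :=
  h.eq_or_lt.resolve_right fun h' => absurd (dim_lt_dim h') (by omega)

/-- If `G < T` and `dim T ≥ dim G + 2`, there is a functional constant on `G` which is not
proportional to a given one on `T`. -/
theorem exists_not_proportional {G T : Δ.Face} (hGT : G < T) (hd : G.dim + 2 ≤ T.dim)
    (h : Dual ℝ V) (c : ℝ) (hG : ∀ x ∈ G.carrier, h x = c) :
    ∃ (g : Dual ℝ V) (e : ℝ), (∀ x ∈ G.carrier, g x = e) ∧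
      ∀ s : ℝ, ¬ ∀ x ∈ T.carrier, g x - e = s * (h x - c) := by
  -- Passing to the kernel of `h` lowers the dimension of `T.direction` by at most one, so a
  -- direction outside `G.direction` is left. A functional vanishing on `G.direction` but not on it
  -- cannot be a multiple of `h` on `T`.
  have hlt : G.direction < T.direction ⊓ LinearMap.ker h := by
    refine lt_of_le_of_ne (le_inf (direction_mono hGT.le) fun v hv => eq_zero_on_direction hG hv)
      fun he => ?_
    have h1 := Submodule.finrank_sup_add_finrank_inf_eq T.direction (LinearMap.ker h)
    have h2 := LinearMap.finrank_range_add_finrank_ker h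
    have h3 : finrank ℝ (LinearMap.range h) ≤ 1 := by
      simpa using Submodule.finrank_le (LinearMap.range h)
    have h4 := Submodule.finrank_le (T.direction ⊔ LinearMap.ker h)
    rw [← he] at h1
    unfold dim at hd
    omega
  obtain ⟨v, ⟨hvT, hvh⟩, hvG⟩ := SetLike.exists_of_lt hlt
  obtain ⟨g, hgv, hgG⟩ := Submodule.exists_le_ker_of_notMem hvG
  obtain ⟨z, hz⟩ := G.nonempty
  refine ⟨g, g z, fun x hx => ?_, fun s hs => hgv ?_⟩
  · have : g (x - z) = 0 := hgG (sub_mem_direction hx hz)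
    rw [map_sub] at this
    linarith
  · have := functional_eq_on_direction (σ := T) (h := g) (g := s • h) (fun x hx y hy => by
      have h1 := hs x hx
      have h2 := hs y hy
      simp only [LinearMap.smul_apply, smul_eq_mul]
      linarith) hvT
    rw [this, LinearMap.smul_apply, LinearMap.mem_ker.1 hvh, smul_zero]

variable [IsTopologicalAddGroup V] [ContinuousSMul ℝ V] [T2Space V]

/-- Faces of faces are faces of `Δ`, so a functional need only be minimised over `σ`. -/
theorem exists_of_functional (σ : Δ.Face) (g : Dual ℝ V) (e : ℝ) (he : ∀ x ∈ σ.carrier, e ≤ g x)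
    (hne : ∃ x ∈ σ.carrier, g x = e) :
    ∃ τ : Δ.Face, ∀ x, x ∈ τ.carrier ↔ x ∈ σ.carrier ∧ g x = e := by
  obtain ⟨I, hI⟩ := Δ.exists_finset
  obtain ⟨h, c, hc, hσ⟩ := σ.exists_functional
  change Δ.carrier = solutionSet I at hI
  obtain ⟨x₀, hx₀, hx₀e⟩ := hne
  rw [hI] at hc hσ
  have hsub := σ.subset_carrier
  rw [hI] at hsub
  obtain ⟨k, a, hka, hk⟩ := exists_functional_face_trans (I := I) (g := g) (e := e) hc
    (fun x hx hxc => he x ((hσ x hx).1 hxc))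
    ⟨x₀, hsub hx₀, (hσ x₀ (hsub hx₀)).2 hx₀, hx₀e⟩
  have hmem : ∀ x, x ∈ solutionSet I ∧ k x = a ↔ x ∈ σ.carrier ∧ g x = e := fun x =>
    ⟨fun hx => ⟨(hσ x hx.1).1 ((hk x hx.1).1 hx.2).1, ((hk x hx.1).1 hx.2).2⟩,
      fun hx => ⟨hsub hx.1, (hk x (hsub hx.1)).2 ⟨(hσ x (hsub hx.1)).2 hx.1, hx.2⟩⟩⟩
  refine ⟨⟨{x | x ∈ solutionSet I ∧ k x = a}, fun _ => ⟨LinearMap.toContinuousLinearMap (-k), ?_⟩,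
    ⟨x₀, (hmem x₀).2 ⟨hx₀, hx₀e⟩⟩⟩, hmem⟩
  rw [hI]
  obtain ⟨hx₀I, hx₀a⟩ := (hmem x₀).2 ⟨hx₀, hx₀e⟩
  ext x
  simp only [Set.mem_ofPred_eq, LinearMap.coe_toContinuousLinearMap', LinearMap.neg_apply,
    neg_le_neg_iff]
  refine and_congr_right fun hx => ⟨fun h y hy => h ▸ hka y hy, fun h => ?_⟩
  exact (hx₀a ▸ h x₀ hx₀I).antisymm (hka x hx)

/-- If `G < T` are faces, `h` attains its minimum `c` over `T` exactly on `G`, and `g` is constant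
on `G`, then the maximal ratio of `g` and `h` is attained exactly on a face `F > G` of `T`. -/
theorem exists_maxRatio_face {G T : Δ.Face} (hGT : G < T) {h g : Dual ℝ V} {c e : ℝ}
    (hc : ∀ x ∈ T.carrier, c ≤ h x) (hG : ∀ x ∈ T.carrier, h x = c ↔ x ∈ G.carrier)
    (hg : ∀ x ∈ G.carrier, g x = e) :
    ∃ (s : ℝ) (F : Δ.Face), G < F ∧ F ≤ T ∧
      (∀ x ∈ T.carrier, g x - e ≤ s * (h x - c)) ∧
      ∀ x ∈ T.carrier, g x - e = s * (h x - c) ↔ x ∈ F.carrier := by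
  obtain ⟨I, hI⟩ := T.exists_solutionSet
  obtain ⟨x₁, hx₁, hx₁G⟩ := exists_mem_notMem_of_lt hGT
  obtain ⟨x₀, hx₀⟩ := G.nonempty
  obtain ⟨s, hs, y, hy, hyc, hye⟩ := exists_max_ratio (I := I) (h := h) (g := g) (c := c) (e := e)
    (hI ▸ hc) (hI ▸ ⟨x₀, hGT.le hx₀, (hG x₀ (hGT.le hx₀)).2 hx₀⟩)
    (hI ▸ ⟨x₁, hx₁, fun h => hx₁G ((hG x₁ hx₁).1 h)⟩)
    (hI ▸ fun x hx hxc => hg x ((hG x hx).1 hxc))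
  rw [← hI] at hs hy
  obtain ⟨F, hF⟩ := T.exists_of_functional (s • h - g) (s * c - e) (fun x hx => by
    have := hs x hx
    simp only [LinearMap.sub_apply, LinearMap.smul_apply, smul_eq_mul]
    linarith) ⟨y, hy, by
      simp only [LinearMap.sub_apply, LinearMap.smul_apply, smul_eq_mul]
      linarith⟩
  have hF' : ∀ x ∈ T.carrier, g x - e = s * (h x - c) ↔ x ∈ F.carrier := fun x hx => by
    rw [hF]
    simp only [LinearMap.sub_apply, LinearMap.smul_apply, smul_eq_mul]
    exact ⟨fun h => ⟨hx, by linarith⟩, fun h => by linarith [h.2]⟩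
  refine ⟨s, F, ⟨fun x hx => ?_, fun hle => ?_⟩, fun x hx => ((hF x).1 hx).1, hs, hF'⟩
  · have hxT := hGT.le hx
    refine (hF' x hxT).1 ?_
    rw [hg x hx, (hG x hxT).2 hx]
    ring
  · exact hyc ((hG y hy).2 (hle ((hF' y hy).1 hye)))

/-- Two different faces strictly between `G` and `T` if `dim T ≥ dim G + 2`. -/
theorem exists_pair_between {G T : Δ.Face} (hGT : G < T) (hd : G.dim + 2 ≤ T.dim) :
    ∃ F₁ F₂ : Δ.Face, F₁ ≠ F₂ ∧ G < F₁ ∧ F₁ < T ∧ G < F₂ ∧ F₂ < T := by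
  obtain ⟨h, c, hc, hG⟩ := G.exists_functional
  obtain ⟨g, e, hg, hgs⟩ := exists_not_proportional hGT hd h c
    fun x hx => (hG x (G.subset_carrier hx)).2 hx
  obtain ⟨s, F, hGF, hFT, hs, hF⟩ := exists_maxRatio_face hGT (h := h) (g := g) (c := c) (e := e)
    (fun x hx => hc x (T.subset_carrier hx)) (fun x hx => hG x (T.subset_carrier hx)) hg
  -- `F'` is the face of minimal ratio. If `F = F'`, or if one of them were `T`, the ratio would be
  -- constant on `T`, against the choice of `g`.
  obtain ⟨s', F', hGF', hFT', hs', hF'⟩ := exists_maxRatio_face hGT (h := h) (g := -g) (c := c)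
    (e := -e) (fun x hx => hc x (T.subset_carrier hx)) (fun x hx => hG x (T.subset_carrier hx))
    fun x hx => by rw [LinearMap.neg_apply, hg x hx]
  simp only [LinearMap.neg_apply] at hs' hF'
  refine ⟨F, F', ?_, hGF, lt_of_le_of_ne hFT ?_, hGF', lt_of_le_of_ne hFT' ?_⟩
  · rintro rfl
    obtain ⟨y, hy, hyG⟩ := exists_mem_notMem_of_lt hGF
    have hyT := hFT hy
    have h1 := (hF y hyT).2 hy
    have h2 := (hF' y hyT).2 hy
    have h3 : h y - c ≠ 0 := fun h0 => hyG ((hG y (T.subset_carrier hyT)).1 (by linarith))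
    have h4 : s' = -s := by
      have : (s' + s) * (h y - c) = 0 := by linarith
      rcases mul_eq_zero.1 this with h | h
      · linarith
      · exact absurd h h3
    refine hgs s fun x hx => ?_
    have h5 := hs x hx
    have h6 := hs' x hx
    rw [h4] at h6
    linarith
  · rintro rfl
    exact hgs s fun x hx => (hF x hx).2 hx
  · rintro rfl
    exact hgs (-s') fun x hx => by linarith [(hF' x hx).2 hx]

end Face
end Polyhedron
end CechPoly

/-! ### The sweep: acyclicity of intervals of faces. -/

namespace CechPoly
namespace Polyhedron

open Module

variable {V : Type u} [AddCommGroup V] [Module ℝ V] [TopologicalSpace V] {Δ : Polyhedron V}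

namespace Face

/-- The faces `F` with `G ≤ F ≤ T` such that `g < e` on `F \ G`. -/
def descending (G T : Δ.Face) (g : Dual ℝ V) (e : ℝ) : Set Δ.Face :=
  {F | G ≤ F ∧ F ≤ T ∧ ∀ x ∈ F.carrier, x ∉ G.carrier → g x < e}

theorem ordConnected_descending (G T : Δ.Face) (g : Dual ℝ V) (e : ℝ) :
    (descending G T g e).OrdConnected :=
  ⟨fun _ hx _ hy _ hz => ⟨hx.1.trans hz.1, hz.2.trans hy.2.1, fun _ h => hy.2.2 _ (hz.2 h)⟩⟩

variable [FiniteDimensional ℝ V] [IsTopologicalAddGroup V] [ContinuousSMul ℝ V] [T2Space V]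

/-- Take the face on which `-g` has the largest ratio to a functional exposing `G`; the point `y`
shows that this ratio is positive. -/
theorem exists_ne_mem_descending {G T : Δ.Face} (hGT : G ≤ T) {g : Dual ℝ V} {e : ℝ}
    (hg : ∀ x ∈ G.carrier, g x = e) {y : V} (hy : y ∈ T.carrier) (hye : g y < e) :
    ∃ F ∈ descending G T g e, F ≠ G := by
  have hlt : G < T := lt_of_le_of_ne hGT (by rintro rfl; exact hye.ne (hg y hy))
  obtain ⟨k, a, hka, hk⟩ := G.exists_functional
  obtain ⟨s, F, hGF, hFT, hs, hF⟩ := exists_maxRatio_face hlt (h := k) (g := -g) (c := a)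
    (e := -e) (fun x hx => hka x (T.subset_carrier hx)) (fun x hx => hk x (T.subset_carrier hx))
    fun x hx => by rw [LinearMap.neg_apply, hg x hx]
  simp only [LinearMap.neg_apply] at hs hF
  have hs0 : 0 < s := by
    have h1 := hs y hy
    have h2 := hka y (T.subset_carrier hy)
    exact pos_of_mul_pos_left (by linarith : 0 < s * (k y - a)) (by linarith)
  refine ⟨F, ⟨hGF.le, hFT, fun x hx hxG => ?_⟩, hGF.ne'⟩
  have h1 := (hF x (hFT hx)).2 hx
  have hxΔ := F.subset_carrier hx
  have h2 : a < k x := lt_of_le_of_ne (hka x hxΔ) fun h => hxG ((hk x hxΔ).1 h.symm)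
  have := mul_pos hs0 (sub_pos.2 h2)
  linarith

variable [Fintype Δ.Face] {d : Δ.Face → Δ.Face → ℤ}

/-- One step of the sweep by the ratio of `g` and `h`: the complex of descending faces is filtered
by complexes of descending faces of smaller intervals. -/
theorem isAcyclicOn_descending_of_not_proportional (hd : ∀ σ τ, d σ τ ≠ 0 → τ ≤ σ)
    (hdd : ∀ σ ρ, ∑ τ, d σ τ * d τ ρ = 0) {G T : Δ.Face} (hGT : G < T)
    (ih : ∀ (G' T' : Δ.Face) (g : Dual ℝ V) (e : ℝ), G ≤ G' → T' ≤ T → (G' ≠ G ∨ T' ≠ T) →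
      (∀ x ∈ G'.carrier, g x = e) → (∃ F ∈ descending G' T' g e, F ≠ G') →
      IsAcyclicOn d (descending G' T' g e)) {h : Dual ℝ V} {c : ℝ}
    (hc : ∀ x ∈ T.carrier, c ≤ h x) (hG : ∀ x ∈ T.carrier, h x = c ↔ x ∈ G.carrier)
    {g : Dual ℝ V} {e : ℝ} (hg : ∀ x ∈ G.carrier, g x = e)
    (hgs : ∀ s : ℝ, ¬ ∀ x ∈ T.carrier, g x - e = s * (h x - c))
    (hne : ∃ F ∈ descending G T g e, F ≠ G) : IsAcyclicOn d (descending G T g e) := by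
  classical
  have hpos : ∀ x ∈ T.carrier, x ∉ G.carrier → 0 < h x - c := fun x hx hxG =>
    sub_pos.2 (lt_of_le_of_ne (hc x hx) fun h => hxG ((hG x hx).1 h.symm))
  have : Nonempty Δ.Face := ⟨G⟩
  have key : ∀ F : Δ.Face, G < F → F ≤ T → ∃ (s : ℝ) (A : Δ.Face), G < A ∧ A ≤ F ∧
      (∀ x ∈ F.carrier, g x - e ≤ s * (h x - c)) ∧
      ∀ x ∈ F.carrier, g x - e = s * (h x - c) ↔ x ∈ A.carrier := fun F hGF hFT =>
    exists_maxRatio_face hGF (fun x hx => hc x (hFT hx)) (fun x hx => hG x (hFT hx)) hg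
  choose! t A hGA hAF ht hA using key
  -- `t₀` is the smallest ratio on `T` and `M` the face where it is attained, whereas `t F` and `A
  -- F` record the largest ratio on `F`.
  obtain ⟨t₀, M, hGM, hMT, ht₀, hM⟩ : ∃ (t₀ : ℝ) (M : Δ.Face), G < M ∧ M ≤ T ∧
      (∀ x ∈ T.carrier, t₀ * (h x - c) ≤ g x - e) ∧
      ∀ x ∈ T.carrier, g x - e = t₀ * (h x - c) ↔ x ∈ M.carrier := by
    obtain ⟨s, M, hGM, hMT, hs, hM⟩ := exists_maxRatio_face hGT (h := h) (g := -g) (c := c)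
      (e := -e) hc hG fun x hx => by rw [LinearMap.neg_apply, hg x hx]
    refine ⟨-s, M, hGM, hMT, fun x hx => ?_, fun x hx => ?_⟩
    · have := hs x hx
      rw [LinearMap.neg_apply] at this
      linarith
    · rw [← hM x hx, LinearMap.neg_apply]
      constructor <;> intro h <;> linarith
  have hMne : M ≠ T := by
    rintro rfl
    exact hgs t₀ fun x hx => (hM x hx).2 hx
  have htlt : ∀ F ∈ descending G T g e, G < F → t F < 0 := by
    intro F hF hGF
    obtain ⟨y, hy, hyG⟩ := exists_mem_notMem_of_lt (hGA F hGF hF.2.1)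
    have hyF := hAF F hGF hF.2.1 hy
    have h1 := (hA F hGF hF.2.1 y hyF).2 hy
    have h2 := hF.2.2 y hyF hyG
    exact neg_of_mul_neg_left (by linarith : t F * (h y - c) < 0) (hpos y (hF.2.1 hyF) hyG).le
  have ht₀lt : ∀ F, G ≤ F → F ≤ T → ¬ F ≤ M → t₀ < t F := by
    intro F hGF hFT hFM
    have hGF' : G < F := lt_of_le_of_ne hGF (by rintro rfl; exact hFM hGM.le)
    obtain ⟨x, hx, hxM⟩ := Set.not_subset.1 hFM
    have h1 := ht F hGF' hFT x hx
    have h2 := lt_of_le_of_ne (ht₀ x (hFT hx)) fun h => hxM ((hM x (hFT hx)).1 h.symm)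
    have h3 := hpos x (hFT hx) fun h => hxM (hGM.le h)
    exact lt_of_mul_lt_mul_right (h2.trans_le h1) h3.le
  have ht₀neg : t₀ < 0 := by
    obtain ⟨F, hF, hFG⟩ := hne
    have hGF := lt_of_le_of_ne hF.1 hFG.symm
    obtain ⟨y, hy, hyG⟩ := exists_mem_notMem_of_lt hGF
    have h1 := hF.2.2 y hy hyG
    have h2 := ht₀ y (hF.2.1 hy)
    exact neg_of_mul_neg_left (by linarith : t₀ * (h y - c) < 0) (hpos y (hF.2.1 hy) hyG).le
  -- The faces below `M` form one lowest block. It absorbs `G`, on which no ratio is defined; every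
  -- other face has `t F > t₀`.
  let m : Δ.Face → ℝ ×ₗ Δ.Face := fun F => if F ≤ M then toLex (t₀, G) else toLex (t F, A F)
  have hmlow : ∀ F, F ≤ M → m F = toLex (t₀, G) := fun F hF => if_pos hF
  have hmhigh : ∀ F, ¬ F ≤ M → m F = toLex (t F, A F) := fun F hF => if_neg hF
  have hGlt : ∀ F, G ≤ F → ¬ F ≤ M → G < F := fun F hGF hFM =>
    lt_of_le_of_ne hGF (by rintro rfl; exact hFM hGM.le)
  refine IsAcyclicOn.of_fibers hd hdd (m := m) (ordConnected_descending G T g e) ?_ ?_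
  · intro F₁ hF₁ F₂ hF₂ hle
    by_cases h1 : F₁ ≤ M
    · rw [hmlow F₁ h1]
      by_cases h2 : F₂ ≤ M
      · rw [hmlow F₂ h2]
      · rw [hmhigh F₂ h2, Prod.Lex.toLex_le_toLex]
        exact Or.inl (ht₀lt F₂ hF₂.1 hF₂.2.1 h2)
    · have h2 : ¬ F₂ ≤ M := fun h => h1 (hle.trans h)
      have hG1 := hGlt F₁ hF₁.1 h1
      have hG2 := hGlt F₂ hF₂.1 h2
      rw [hmhigh F₁ h1, hmhigh F₂ h2, Prod.Lex.toLex_le_toLex]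
      have htle : t F₁ ≤ t F₂ := by
        obtain ⟨y, hy, hyG⟩ := exists_mem_notMem_of_lt (hGA F₁ hG1 hF₁.2.1)
        have hyF := hAF F₁ hG1 hF₁.2.1 hy
        have h3 := (hA F₁ hG1 hF₁.2.1 y hyF).2 hy
        have h4 := ht F₂ hG2 hF₂.2.1 y (hle hyF)
        rw [h3] at h4
        exact le_of_mul_le_mul_right h4 (hpos y (hF₁.2.1 hyF) hyG)
      refine htle.lt_or_eq.imp_right fun heq => ⟨heq, fun x hx => ?_⟩
      have hxF := hAF F₁ hG1 hF₁.2.1 hx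
      refine (hA F₂ hG2 hF₂.2.1 x (hle hxF)).1 ?_
      rw [← show t F₁ = t F₂ from heq]
      exact (hA F₁ hG1 hF₁.2.1 x hxF).2 hx
  · intro σ hσ
    by_cases hσM : σ ≤ M
    · have : {τ ∈ descending G T g e | m τ = m σ} = descending G M g e := by
        ext τ
        rw [Set.mem_ofPred_eq, hmlow σ hσM]
        constructor
        · rintro ⟨hτ, hmτ⟩
          have hτM : τ ≤ M := by
            by_contra hτM
            rw [hmhigh τ hτM, toLex_inj, Prod.mk.injEq] at hmτ
            exact (ht₀lt τ hτ.1 hτ.2.1 hτM).ne' hmτ.1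
          exact ⟨hτ.1, hτM, hτ.2.2⟩
        · intro hτ
          exact ⟨⟨hτ.1, hτ.2.1.trans hMT, hτ.2.2⟩, hmlow τ hτ.2.1⟩
      rw [this]
      refine ih G M g e le_rfl hMT (Or.inr hMne) hg ⟨M, ⟨hGM.le, le_rfl, fun x hx hxG => ?_⟩,
        hGM.ne'⟩
      have h1 := (hM x (hMT hx)).2 hx
      have h2 := mul_neg_of_neg_of_pos ht₀neg (hpos x (hMT hx) hxG)
      linarith
    · have hGσ := hGlt σ hσ.1 hσM
      have hσT := hσ.2.1
      have htσ := htlt σ hσ hGσ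
      have hAσ := hAF σ hGσ hσT
      have hGAσ := hGA σ hGσ hσT
      have hAeq : ∀ x ∈ (A σ).carrier, g x - e = t σ * (h x - c) := fun x hx =>
        (hA σ hGσ hσT x (hAσ hx)).2 hx
      have htt := ht₀lt σ hσ.1 hσT hσM
      -- A face has maximal ratio `t σ`, attained exactly on `A σ`, precisely when it contains `A σ`
      -- and `g - t σ • h` decreases away from `A σ`. As `t σ < 0`, such a face also descends from
      -- `G` with respect to `g`.
      have : {τ ∈ descending G T g e | m τ = m σ} =
          descending (A σ) T (g - t σ • h) (e - t σ * c) := by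
        ext τ
        rw [Set.mem_ofPred_eq, hmhigh σ hσM]
        constructor
        · rintro ⟨hτ, hmτ⟩
          have hτM : ¬ τ ≤ M := by
            intro hτM
            rw [hmlow τ hτM, toLex_inj, Prod.mk.injEq] at hmτ
            exact htt.ne hmτ.1
          rw [hmhigh τ hτM, toLex_inj, Prod.mk.injEq] at hmτ
          have hGτ := hGlt τ hτ.1 hτM
          refine ⟨hmτ.2 ▸ hAF τ hGτ hτ.2.1, hτ.2.1, fun x hx hxA => ?_⟩
          have h1 := ht τ hGτ hτ.2.1 x hx
          have h2 := lt_of_le_of_ne h1 fun h =>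
            hxA (hmτ.2 ▸ (hA τ hGτ hτ.2.1 x hx).1 h)
          rw [hmτ.1] at h2
          simp only [LinearMap.sub_apply, LinearMap.smul_apply, smul_eq_mul]
          linarith
        · rintro ⟨hAτ, hτT, hτ⟩
          simp only [LinearMap.sub_apply, LinearMap.smul_apply, smul_eq_mul] at hτ
          have hGτ : G < τ := hGAσ.trans_le hAτ
          obtain ⟨y, hy, hyG⟩ := exists_mem_notMem_of_lt hGAσ
          have hyT := hτT (hAτ hy)
          have hτM : ¬ τ ≤ M := by
            intro hτM
            have h1 := (hM y hyT).2 (hτM (hAτ hy))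
            rw [hAeq y hy] at h1
            exact htt.ne' (mul_right_cancel₀ (hpos y hyT hyG).ne' h1)
          have htτ : t τ = t σ := by
            apply le_antisymm
            · obtain ⟨y', hy', hyG'⟩ := exists_mem_notMem_of_lt (hGA τ hGτ hτT)
              have hyτ := hAF τ hGτ hτT hy'
              have h1 := (hA τ hGτ hτT y' hyτ).2 hy'
              refine le_of_mul_le_mul_right ?_ (hpos y' (hτT hyτ) hyG')
              rw [← h1]
              by_cases hyA : y' ∈ (A σ).carrier
              · exact (hAeq y' hyA).le
              · linarith [hτ y' hyτ hyA]
            · have h1 := ht τ hGτ hτT y (hAτ hy)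
              rw [hAeq y hy] at h1
              exact le_of_mul_le_mul_right h1 (hpos y hyT hyG)
          have hAA : A τ = A σ := by
            refine Face.ext_carrier (Set.ext fun x => ⟨fun hx => ?_, fun hx => ?_⟩)
            · by_contra hxA
              have hxτ := hAF τ hGτ hτT hx
              have h1 := (hA τ hGτ hτT x hxτ).2 hx
              rw [htτ] at h1
              linarith [hτ x hxτ hxA]
            · refine (hA τ hGτ hτT x (hAτ hx)).1 ?_
              rw [htτ, hAeq x hx]
          refine ⟨⟨hGτ.le, hτT, fun x hx hxG => ?_⟩, ?_⟩
          · have h1 := mul_neg_of_neg_of_pos htσ (hpos x (hτT hx) hxG)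
            by_cases hxA : x ∈ (A σ).carrier
            · linarith [hAeq x hxA]
            · linarith [hτ x hx hxA]
          · rw [hmhigh τ hτM, htτ, hAA]
      rw [this]
      have hconst : ∀ x ∈ (A σ).carrier, (g - t σ • h) x = e - t σ * c := fun x hx => by
        simp only [LinearMap.sub_apply, LinearMap.smul_apply, smul_eq_mul]
        linarith [hAeq x hx]
      refine ih (A σ) T _ _ hGAσ.le le_rfl (Or.inl hGAσ.ne') hconst ?_
      -- On `M \ G` the ratio is `t₀ < t σ`, so the block contains more than its bottom face `A σ`.
      obtain ⟨y, hy, hyG⟩ := exists_mem_notMem_of_lt hGM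
      refine exists_ne_mem_descending (hAσ.trans hσT) hconst (hMT hy) ?_
      have h1 := (hM y (hMT hy)).2 hy
      have h2 := mul_lt_mul_of_pos_right htt (hpos y (hMT hy) hyG)
      simp only [LinearMap.sub_apply, LinearMap.smul_apply, smul_eq_mul]
      linarith

/-- Induction on the difference of dimensions. If `g` is proportional to `h`, the sweep sees only
one ratio; but then the family is the whole interval, which does not depend on `g`, and `g` may be
exchanged for another functional unless the dimensions differ by only one. -/
theorem isAcyclicOn_descending (hd : ∀ σ τ, d σ τ ≠ 0 → τ < σ)
    (hd1 : ∀ σ τ, τ < σ → σ.dim = τ.dim + 1 → d σ τ = 1 ∨ d σ τ = -1)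
    (hdd : ∀ σ ρ, ∑ τ, d σ τ * d τ ρ = 0) {G T : Δ.Face} {g : Dual ℝ V} {e : ℝ}
    (hg : ∀ x ∈ G.carrier, g x = e) (hne : ∃ F ∈ descending G T g e, F ≠ G) :
    IsAcyclicOn d (descending G T g e) := by
  induction hn : T.dim - G.dim using Nat.strong_induction_on generalizing G T g e with
  | _ n ih =>
  have hd' : ∀ σ τ, d σ τ ≠ 0 → τ ≤ σ := fun σ τ h => (hd σ τ h).le
  have hd0 : ∀ σ τ, ¬ τ < σ → d σ τ = 0 := fun σ τ h => by_contra fun h' => h (hd σ τ h')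
  obtain ⟨F, hF, hFG⟩ := hne
  have hGT : G < T := (lt_of_le_of_ne hF.1 hFG.symm).trans_le hF.2.1
  have hdim := dim_lt_dim hGT
  obtain ⟨h, c, hc, hG⟩ := G.exists_functional
  replace hc : ∀ x ∈ T.carrier, c ≤ h x := fun x hx => hc x (T.subset_carrier hx)
  replace hG : ∀ x ∈ T.carrier, h x = c ↔ x ∈ G.carrier := fun x hx => hG x (T.subset_carrier hx)
  have step : ∀ (g : Dual ℝ V) (e : ℝ), (∀ x ∈ G.carrier, g x = e) →
      (∀ s : ℝ, ¬ ∀ x ∈ T.carrier, g x - e = s * (h x - c)) →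
      (∃ F ∈ descending G T g e, F ≠ G) → IsAcyclicOn d (descending G T g e) := by
    intro g e hg hgs hne
    refine isAcyclicOn_descending_of_not_proportional hd' hdd hGT ?_ hc hG hg hgs hne
    intro G' T' g' e' hGG' hTT' hor hg' hne'
    refine ih _ ?_ hg' hne' rfl
    have h1 := dim_le_dim hGG'
    have h2 := dim_le_dim hTT'
    rcases hor with hor | hor
    · have := dim_lt_dim (lt_of_le_of_ne hGG' hor.symm)
      omega
    · have := dim_lt_dim (lt_of_le_of_ne hTT' hor)
      omega
  by_cases hgs : ∀ s : ℝ, ¬ ∀ x ∈ T.carrier, g x - e = s * (h x - c)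
  · exact step g e hg hgs ⟨F, hF, hFG⟩
  push Not at hgs
  obtain ⟨s, hs⟩ := hgs
  have hpos : ∀ x ∈ T.carrier, x ∉ G.carrier → 0 < h x - c := fun x hx hxG =>
    sub_pos.2 (lt_of_le_of_ne (hc x hx) fun h => hxG ((hG x hx).1 h.symm))
  have hs0 : s < 0 := by
    obtain ⟨y, hy, hyG⟩ := exists_mem_notMem_of_lt (lt_of_le_of_ne hF.1 hFG.symm)
    have h1 := hs y (hF.2.1 hy)
    have h2 := hF.2.2 y hy hyG
    exact neg_of_mul_neg_left (by linarith : s * (h y - c) < 0) (hpos y (hF.2.1 hy) hyG).le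
  have hall : descending G T g e = Set.Icc G T := by
    refine Set.ext fun τ => ⟨fun hτ => ⟨hτ.1, hτ.2.1⟩, fun hτ => ⟨hτ.1, hτ.2, fun x hx hxG => ?_⟩⟩
    have h1 := mul_neg_of_neg_of_pos hs0 (hpos x (hτ.2 hx) hxG)
    linarith [hs x (hτ.2 hx)]
  rw [hall]
  rcases Nat.lt_or_ge T.dim (G.dim + 2) with hlt | hge
  · have : Set.Icc G T = {T, G} := by
      refine Set.ext fun τ => ⟨fun hτ => ?_, ?_⟩
      · by_cases hτd : T.dim ≤ τ.dim
        · exact Or.inl (eq_of_le_of_dim_le hτ.2 hτd)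
        · exact Or.inr (eq_of_le_of_dim_le hτ.1 (by omega)).symm
      · rintro (rfl | rfl)
        · exact ⟨hGT.le, le_rfl⟩
        · exact ⟨le_rfl, hGT.le⟩
    rw [this]
    exact isAcyclicOn_pair hGT.ne' (hd1 T G hGT (by omega)) (hd0 _ _ (lt_irrefl _))
      (hd0 _ _ (lt_irrefl _)) (hd0 _ _ hGT.not_gt)
  · obtain ⟨k, a, hk, hks⟩ := exists_not_proportional hGT hge h c
      fun x hx => (hG x (hGT.le hx)).2 hx
    -- With `r` the largest ratio of `k`, the functional `k - (r + 1) • h` has ratio at most `-1`.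
    -- So it decreases on the whole interval, and it is still not proportional to `h`.
    obtain ⟨r, -, -, -, hr, -⟩ := exists_maxRatio_face hGT hc hG hk
    have hG' : ∀ x ∈ G.carrier, (k - (r + 1) • h) x = a - (r + 1) * c := fun x hx => by
      simp only [LinearMap.sub_apply, LinearMap.smul_apply, smul_eq_mul]
      rw [hk x hx, (hG x (hGT.le hx)).2 hx]
    have hall' : descending G T (k - (r + 1) • h) (a - (r + 1) * c) = Set.Icc G T := by
      refine Set.ext fun τ => ⟨fun hτ => ⟨hτ.1, hτ.2.1⟩,
        fun hτ => ⟨hτ.1, hτ.2, fun x hx hxG => ?_⟩⟩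
      have h1 := hpos x (hτ.2 hx) hxG
      have h2 := hr x (hτ.2 hx)
      simp only [LinearMap.sub_apply, LinearMap.smul_apply, smul_eq_mul]
      linarith
    rw [← hall']
    refine step _ _ hG' (fun s' hs' => hks (s' + (r + 1)) fun x hx => ?_)
      ⟨T, by rw [hall']; exact ⟨hGT.le, le_rfl⟩, hGT.ne'⟩
    have := hs' x hx
    simp only [LinearMap.sub_apply, LinearMap.smul_apply, smul_eq_mul] at this
    linarith

/-- The cellular complex of a nontrivial interval in the face lattice of a polyhedron is acyclic. -/
theorem isAcyclicOn_Icc (hd : ∀ σ τ, d σ τ ≠ 0 → τ < σ)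
    (hd1 : ∀ σ τ, τ < σ → σ.dim = τ.dim + 1 → d σ τ = 1 ∨ d σ τ = -1)
    (hdd : ∀ σ ρ, ∑ τ, d σ τ * d τ ρ = 0) {G T : Δ.Face} (hGT : G < T) :
    IsAcyclicOn d (Set.Icc G T) := by
  obtain ⟨h, c, hc, hG⟩ := G.exists_functional
  have : Set.Icc G T = descending G T (-h) (-c) := by
    refine Set.ext fun τ => ⟨fun hτ => ⟨hτ.1, hτ.2, fun x hx hxG => ?_⟩, fun hτ => ⟨hτ.1, hτ.2.1⟩⟩
    exact neg_lt_neg (lt_of_le_of_ne (hc x (τ.subset_carrier hx)) fun h =>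
      hxG ((hG x (τ.subset_carrier hx)).1 h.symm))
  have hT : T ∈ Set.Icc G T := ⟨hGT.le, le_rfl⟩
  rw [this] at hT ⊢
  exact isAcyclicOn_descending hd hd1 hdd
    (fun x hx => congrArg Neg.neg ((hG x (G.subset_carrier hx)).2 hx)) ⟨T, hT, hGT.ne'⟩

end Face
end Polyhedron
end CechPoly

/-! ### Orientations as alternating forms, and incidence numbers as signs. -/

namespace CechPoly

section LinearAlgebra

open Module

variable {V : Type u} [AddCommGroup V] [Module ℝ V]

/-- Every orientation of a subspace is represented by an alternating form on the whole space. -/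
theorem exists_alternatingMap_orientation {D : Submodule ℝ V} {d : ℕ}
    (o : Orientation ℝ D (Fin d)) : ∃ ω : V [⋀^Fin d]→ₗ[ℝ] ℝ,
      ∀ b : Basis (Fin d) ℝ D, ω (fun i => b i) ≠ 0 ∧
        (b.orientation = o ↔ 0 < ω (fun i => b i)) := by
  induction o using Module.Ray.ind with
  | h ω₀ hω₀ =>
  obtain ⟨p, hp⟩ := D.subtype.exists_leftInverse_of_injective D.ker_subtype
  refine ⟨ω₀.compLinearMap p, fun b => ?_⟩
  have h1 : ω₀.compLinearMap p (fun i => b i) = ω₀ b := by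
    rw [AlternatingMap.compLinearMap_apply]
    congr 1
    funext i
    exact LinearMap.congr_fun hp (b i)
  have h2 : ω₀ b ≠ 0 := (AlternatingMap.map_basis_ne_zero_iff b ω₀).2 hω₀
  rw [h1]
  refine ⟨h2, ?_⟩
  rw [Basis.orientation, ray_eq_iff]
  conv_lhs => rw [AlternatingMap.eq_smul_basis_det b ω₀]
  exact sameRay_smul_right_iff_of_ne b.det_ne_zero h2

theorem exists_basis_vecCons [FiniteDimensional ℝ V] {D E : Submodule ℝ V} {d : ℕ}
    (b : Basis (Fin d) ℝ D) (hDE : D ≤ E) (hE : finrank ℝ E = d + 1) {w : V} (hwE : w ∈ E)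
    (hwD : w ∉ D) : ∃ b' : Basis (Fin (d + 1)) ℝ E,
      ∀ i, (b' i : V) = Matrix.vecCons w (fun i => (b i : V)) i := by
  have hmem : ∀ i, Matrix.vecCons w (fun i => (b i : V)) i ∈ E :=
    Fin.cases hwE fun i => hDE (b i).2
  have hli : LinearIndependent ℝ (Matrix.vecCons w (fun i => (b i : V))) := by
    refine linearIndependent_finCons.2 ⟨b.linearIndependent.map' D.subtype D.ker_subtype,
      fun h => hwD (Submodule.span_le.2 ?_ h)⟩
    rintro _ ⟨i, rfl⟩
    exact (b i).2
  have hli' : LinearIndependent ℝ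
      (fun i => (⟨Matrix.vecCons w (fun i => (b i : V)) i, hmem i⟩ : E)) :=
    LinearIndependent.of_comp E.subtype hli
  refine ⟨Basis.mk hli' (hli'.span_eq_top_of_card_eq_finrank' (by simp [hE])).ge, fun i => ?_⟩
  rw [Basis.mk_apply]

theorem inf_ker_eq [FiniteDimensional ℝ V] {D E : Submodule ℝ V} (hDE : D ≤ E)
    (hd : finrank ℝ E = finrank ℝ D + 1) {k : Dual ℝ V} (hk : ∀ v ∈ D, k v = 0) {w : V}
    (hwE : w ∈ E) (hw : k w ≠ 0) : E ⊓ LinearMap.ker k = D := by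
  refine (Submodule.eq_of_le_of_finrank_le (le_inf hDE fun v hv => hk v hv) ?_).symm
  have : E ⊓ LinearMap.ker k < E :=
    lt_of_le_of_ne inf_le_left fun h => hw ((h.symm ▸ hwE : w ∈ E ⊓ LinearMap.ker k).2)
  have := Submodule.finrank_lt_finrank_of_lt this
  omega

theorem sup_span_eq [FiniteDimensional ℝ V] {D E : Submodule ℝ V} (hDE : D ≤ E)
    (hd : finrank ℝ E = finrank ℝ D + 1) {w : V} (hwE : w ∈ E) (hw : w ∉ D) :
    D ⊔ Submodule.span ℝ {w} = E := by
  refine Submodule.eq_of_le_of_finrank_le (sup_le hDE (by simpa using hwE)) ?_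
  have : D < D ⊔ Submodule.span ℝ {w} := lt_of_le_of_ne le_sup_left fun h =>
    hw (h ▸ Submodule.mem_sup_right (Submodule.mem_span_singleton_self w))
  have := Submodule.finrank_lt_finrank_of_lt this
  omega

/-- Whether the orientations given by two forms agree does not depend on the bases compared. -/
theorem mul_vecCons_pos_of_pos [FiniteDimensional ℝ V] {D E : Submodule ℝ V} {d : ℕ}
    (hDE : D ≤ E) (hd : finrank ℝ E = finrank ℝ D + 1) {k : Dual ℝ V} (hk : ∀ v ∈ D, k v = 0)
    (α : V [⋀^Fin (d + 1)]→ₗ[ℝ] ℝ) (β : V [⋀^Fin d]→ₗ[ℝ] ℝ) (b b' : Basis (Fin d) ℝ D)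
    {w w' : V} (hw : w ∈ E) (hw' : w' ∈ E) (hkw : 0 < k w) (hkw' : 0 < k w')
    (h : 0 < α (Matrix.vecCons w fun i => b i) * β fun i => b i) :
    0 < α (Matrix.vecCons w' fun i => b' i) * β fun i => b' i := by
  -- Modulo `D`, `w'` is a positive multiple of `w`, so this change scales `α` by a positive factor.
  -- Changing the basis of `D` multiplies both `α` and `β` by the same determinant, hence the
  -- product by its square.
  have hr : w' - (k w' / k w) • w ∈ D := by
    rw [← inf_ker_eq hDE hd hk hw hkw.ne']
    refine ⟨E.sub_mem hw' (E.smul_mem _ hw), ?_⟩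
    rw [SetLike.mem_coe, LinearMap.mem_ker, map_sub, map_smul, smul_eq_mul,
      div_mul_cancel₀ _ hkw.ne', sub_self]
  have h1 : α (Matrix.vecCons w' fun i => b' i) =
      k w' / k w * α (Matrix.vecCons w fun i => b' i) := by
    have hz : α (Matrix.vecCons (w' - (k w' / k w) • w) fun i => (b' i : V)) = 0 := by
      refine α.map_linearDependent _ fun hli => (linearIndependent_finCons.1 hli).2 ?_
      have hspan : Submodule.span ℝ (Set.range fun i => (b' i : V)) = D := by
        have := congrArg (Submodule.map D.subtype) b'.span_eq
        rw [Submodule.map_span, ← Set.range_comp, Submodule.map_subtype_top] at this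
        exact this
      rw [hspan]
      exact hr
    rw [← AlternatingMap.curryLeft_apply_apply, map_sub, map_smul, AlternatingMap.sub_apply,
      AlternatingMap.smul_apply, sub_eq_zero] at hz
    exact hz
  have h2 : ∀ γ : V [⋀^Fin d]→ₗ[ℝ] ℝ,
      γ (fun i => b' i) = (γ fun i => b i) * b.det b' := fun γ => by
    have := congrArg (fun f => f b')
      (AlternatingMap.eq_smul_basis_det b (γ.compLinearMap D.subtype))
    exact this
  have h3 := h2 (α.curryLeft w)
  simp only [AlternatingMap.curryLeft_apply_apply] at h3
  have h4 : 0 < b.det b' ^ 2 := by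
    have := (b.isUnit_det b').ne_zero
    positivity
  rw [h1, h3, h2 β]
  have : 0 < k w' / k w * ((α (Matrix.vecCons w fun i => b i) * β fun i => b i) *
      b.det b' ^ 2) := by positivity
  linarith

end LinearAlgebra

theorem mul_pos_iff_of_ne_zero {a b : ℝ} (ha : a ≠ 0) (hb : b ≠ 0) :
    0 < a * b ↔ (0 < a ↔ 0 < b) := by
  rcases ha.lt_or_gt with ha | ha <;> rcases hb.lt_or_gt with hb | hb
  · simp [mul_pos_of_neg_of_neg ha hb, ha.not_gt, hb.not_gt]
  · simp [(mul_neg_of_neg_of_pos ha hb).not_gt, ha.not_gt, hb]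
  · simp [(mul_neg_of_pos_of_neg ha hb).not_gt, ha, hb.not_gt]
  · simp [mul_pos ha hb, ha, hb]

namespace Polyhedron

open Module

variable {V : Type u} [AddCommGroup V] [Module ℝ V] [TopologicalSpace V] {Δ : Polyhedron V}

/-- An alternating form on `V` of degree `d = dim σ` which represents the orientation of `σ`. -/
def orientationForm (o : Δ.Orientations) (σ : Δ.Face) {d : ℕ} (h : σ.dim = d) :
    V [⋀^Fin d]→ₗ[ℝ] ℝ :=
  (exists_alternatingMap_orientation (o σ)).choose.domDomCongr (finCongr h)

theorem orientationForm_ne_zero (o : Δ.Orientations) (σ : Δ.Face) {d : ℕ} (h : σ.dim = d)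
    (b : Basis (Fin d) ℝ σ.direction) : orientationForm o σ h (fun i => b i) ≠ 0 := by
  subst h
  exact ((exists_alternatingMap_orientation (o σ)).choose_spec b).1

theorem orientation_eq_iff (o : Δ.Orientations) (σ : Δ.Face) {d : ℕ} (h : σ.dim = d)
    (b : Basis (Fin σ.dim) ℝ σ.direction) :
    b.orientation = o σ ↔ 0 < orientationForm o σ h (fun i => b (Fin.cast h.symm i)) := by
  subst h
  exact ((exists_alternatingMap_orientation (o σ)).choose_spec b).2

theorem orientation_eq_iff_self (o : Δ.Orientations) (σ : Δ.Face)
    (b : Basis (Fin σ.dim) ℝ σ.direction) :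
    b.orientation = o σ ↔ 0 < orientationForm o σ rfl (fun i => b i) :=
  orientation_eq_iff o σ rfl b

theorem incidence_eq_one_or (o : Δ.Orientations) (σ τ : Δ.Face) :
    incidence o σ τ = 1 ∨ incidence o σ τ = -1 := by
  unfold incidence
  split_ifs <;> simp

open Face

theorem finrank_direction_eq {σ τ : Δ.Face} {d : ℕ} (hτ : τ.dim = d) (hσ : σ.dim = d + 1) :
    finrank ℝ σ.direction = finrank ℝ τ.direction + 1 := by
  unfold dim at hτ hσ
  omega

variable [FiniteDimensional ℝ V]

/-- `Coherent` asks for one suitable basis and one inward vector; by `mul_vecCons_pos_of_pos` every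
choice gives the same answer. Positivity of the exposing functional `k` on `w` says that `w` points
from `τ` into `σ`. -/
theorem coherent_iff (o : Δ.Orientations) {σ τ : Δ.Face} {d : ℕ} (hτσ : τ ≤ σ) (hτ : τ.dim = d)
    (hσ : σ.dim = d + 1) {k : Dual ℝ V} {c : ℝ} (hkc : ∀ x ∈ Δ.carrier, c ≤ k x)
    (hk : ∀ x ∈ Δ.carrier, k x = c ↔ x ∈ τ.carrier) (b : Basis (Fin d) ℝ τ.direction) {w : V}
    (hw : w ∈ σ.direction) (hkw : 0 < k w) :
    Coherent o σ τ ↔ 0 < orientationForm o σ hσ (Matrix.vecCons w fun i => b i) *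
      orientationForm o τ hτ fun i => b i := by
  subst hτ
  have hk0 : ∀ v ∈ τ.direction, k v = 0 := fun v hv =>
    eq_zero_on_direction (fun x hx => (hk x (τ.subset_carrier hx)).2 hx) hv
  have hpos : ∀ x ∈ σ.carrier \ τ.carrier, ∀ y ∈ τ.carrier, 0 < k (x - y) := by
    intro x hx y hy
    have hxΔ := σ.subset_carrier hx.1
    rw [map_sub, (hk y (τ.subset_carrier hy)).2 hy, sub_pos]
    exact lt_of_le_of_ne (hkc x hxΔ) fun h => hx.2 ((hk x hxΔ).1 h.symm)
  have hfr := finrank_direction_eq rfl hσ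
  have hle := direction_mono hτσ
  constructor
  · rintro ⟨h, v, w', ⟨x, hx, y, hy, hxy⟩, hvw, hiff⟩
    have hw' : (fun i : Fin (τ.dim + 1) => (w' (Fin.cast hσ.symm i) : V)) =
        Matrix.vecCons (x - y) (fun i => (v i : V)) := by
      funext i
      refine Fin.cases ?_ (fun i => ?_) i
      · exact hxy
      · exact hvw i
    rw [orientation_eq_iff o σ hσ, orientation_eq_iff_self o τ, hw', ← mul_pos_iff_of_ne_zero
      _ (orientationForm_ne_zero o τ rfl v)] at hiff
    · exact mul_vecCons_pos_of_pos hle hfr hk0 _ _ v b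
        (sub_mem_direction hx.1 (hτσ hy)) hw (hpos x hx y hy) hkw hiff
    · have := orientationForm_ne_zero o σ hσ (w'.reindex (finCongr hσ))
      rw [← hw']
      simpa using this
  · intro hb
    have hlt : τ < σ := lt_of_le_of_ne hτσ (by rintro rfl; omega)
    obtain ⟨x, hx, hxτ⟩ := exists_mem_notMem_of_lt hlt
    obtain ⟨y, hy⟩ := τ.nonempty
    have hxyD : x - y ∈ σ.direction := sub_mem_direction hx (hτσ hy)
    have hxyk := hpos x ⟨hx, hxτ⟩ y hy
    obtain ⟨b', hb'⟩ := exists_basis_vecCons b hle (d := τ.dim) hσ hxyD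
      fun h => hxyk.ne' (hk0 _ h)
    have hcast : ∀ i : Fin (τ.dim + 1),
        (b'.reindex (finCongr hσ.symm)) (Fin.cast hσ.symm i) = b' i := fun i => by
      rw [Basis.reindex_apply]; rfl
    refine ⟨hσ.symm, b, b'.reindex (finCongr hσ.symm), ⟨x, ⟨hx, hxτ⟩, y, hy, ?_⟩, fun i => ?_, ?_⟩
    · rw [hcast, hb']; rfl
    · rw [hcast, hb']; rfl
    · rw [orientation_eq_iff o σ hσ, orientation_eq_iff_self o τ]
      simp only [hcast]
      rw [← mul_pos_iff_of_ne_zero (orientationForm_ne_zero o σ hσ b')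
        (orientationForm_ne_zero o τ rfl b)]
      simp only [hb']
      exact mul_vecCons_pos_of_pos hle hfr hk0 _ _ b b hw hxyD hkw hxyk hb

/-- As a sign, the incidence number can be multiplied with others by multiplying values of forms. -/
theorem incidence_eq_sign (o : Δ.Orientations) {σ τ : Δ.Face} {d : ℕ} (hτσ : τ ≤ σ)
    (hτ : τ.dim = d) (hσ : σ.dim = d + 1) {k : Dual ℝ V} {c : ℝ}
    (hkc : ∀ x ∈ Δ.carrier, c ≤ k x) (hk : ∀ x ∈ Δ.carrier, k x = c ↔ x ∈ τ.carrier)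
    (b : Basis (Fin d) ℝ τ.direction) {w : V} (hw : w ∈ σ.direction) (hkw : 0 < k w) :
    incidence o σ τ = SignType.sign (orientationForm o σ hσ (Matrix.vecCons w fun i => b i) *
      orientationForm o τ hτ fun i => b i) := by
  unfold incidence
  rw [coherent_iff o hτσ hτ hσ hkc hk b hw hkw]
  split_ifs with h
  · rw [sign_pos h]; rfl
  · have hk0 : ∀ v ∈ τ.direction, k v = 0 := fun v hv =>
      eq_zero_on_direction (fun x hx => (hk x (τ.subset_carrier hx)).2 hx) hv
    obtain ⟨b', hb'⟩ := exists_basis_vecCons b (direction_mono hτσ) hσ hw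
      fun h => hkw.ne' (hk0 _ h)
    have h1 := orientationForm_ne_zero o σ hσ b'
    simp only [hb'] at h1
    have h2 := mul_ne_zero h1 (orientationForm_ne_zero o τ hτ b)
    rw [sign_neg (lt_of_le_of_ne (not_lt.1 h) h2)]
    rfl

end Polyhedron
end CechPoly

/-! ### The boundary matrix squares to zero. -/

namespace CechPoly
namespace Polyhedron

open Module Face

variable {V : Type u} [AddCommGroup V] [Module ℝ V] [TopologicalSpace V] {Δ : Polyhedron V}

open Classical in
/-- The boundary matrix of the cellular complex of a polyhedron. -/
def boundaryCoeff (o : Δ.Orientations) (σ τ : Δ.Face) : ℤ :=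
  if τ < σ ∧ σ.dim = τ.dim + 1 then incidence o σ τ else 0

theorem boundaryCoeff_ne_zero {o : Δ.Orientations} {σ τ : Δ.Face} (h : boundaryCoeff o σ τ ≠ 0) :
    τ < σ ∧ σ.dim = τ.dim + 1 := by
  by_contra h'
  exact h (if_neg h')

theorem boundaryCoeff_eq_one_or {o : Δ.Orientations} {σ τ : Δ.Face} (h : τ < σ)
    (h' : σ.dim = τ.dim + 1) : boundaryCoeff o σ τ = 1 ∨ boundaryCoeff o σ τ = -1 := by
  rw [boundaryCoeff, if_pos ⟨h, h'⟩]
  exact incidence_eq_one_or o σ τ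

theorem notMem_direction {σ : Δ.Face} {k : Dual ℝ V} {c : ℝ}
    (hk : ∀ x ∈ Δ.carrier, k x = c ↔ x ∈ σ.carrier) {v : V} (hv : k v ≠ 0) :
    v ∉ σ.direction := fun h =>
  hv (eq_zero_on_direction (fun x hx => (hk x (σ.subset_carrier hx)).2 hx) h)

theorem sub_notMem_direction {σ : Δ.Face} {x y : V} (hx : x ∈ Δ.carrier) (hxσ : x ∉ σ.carrier)
    (hy : y ∈ σ.carrier) : x - y ∉ σ.direction :=
  fun h => hxσ (mem_of_sub_mem_direction hx hy h)

theorem pos_sub_of_notMem {σ : Δ.Face} {k : Dual ℝ V} {c : ℝ}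
    (hkc : ∀ x ∈ Δ.carrier, c ≤ k x) (hk : ∀ x ∈ Δ.carrier, k x = c ↔ x ∈ σ.carrier) {x y : V}
    (hx : x ∈ Δ.carrier) (hxσ : x ∉ σ.carrier) (hy : y ∈ σ.carrier) : 0 < k (x - y) := by
  rw [map_sub, (hk y (σ.subset_carrier hy)).2 hy, sub_pos]
  exact lt_of_le_of_ne (hkc x hx) fun h => hxσ ((hk x hx).1 h.symm)

variable [FiniteDimensional ℝ V]

/-- Both directions are spanned by that of `ρ` and the one vector `y - z`, so the affine spans
coincide. -/
theorem eq_of_mem_inter {ρ τ₁ τ₂ : Δ.Face} (h₁ : ρ ≤ τ₁) (h₂ : ρ ≤ τ₂)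
    (hd₁ : τ₁.dim = ρ.dim + 1) (hd₂ : τ₂.dim = ρ.dim + 1) {y : V} (hy₁ : y ∈ τ₁.carrier)
    (hy₂ : y ∈ τ₂.carrier) (hy : y ∉ ρ.carrier) : τ₁ = τ₂ := by
  obtain ⟨z, hz⟩ := ρ.nonempty
  have hyz := sub_notMem_direction (τ₁.subset_carrier hy₁) hy hz
  have hdir : τ₁.direction = τ₂.direction :=
    (sup_span_eq (direction_mono h₁) hd₁ (sub_mem_direction hy₁ (h₁ hz)) hyz).symm.trans
      (sup_span_eq (direction_mono h₂) hd₂ (sub_mem_direction hy₂ (h₂ hz)) hyz)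
  refine Face.ext_carrier (Set.ext fun x => ⟨fun hx => ?_, fun hx => ?_⟩)
  · exact mem_of_sub_mem_direction (τ₁.subset_carrier hx) (h₂ hz)
      (hdir ▸ sub_mem_direction hx (h₁ hz))
  · exact mem_of_sub_mem_direction (τ₂.subset_carrier hx) (h₁ hz)
      (hdir ▸ sub_mem_direction hx (h₂ hz))

/-- There are at most two faces strictly between two faces whose dimensions differ by two. -/
theorem eq_or_eq_of_between {ρ σ τ₁ τ₂ τ : Δ.Face} (hd : σ.dim = ρ.dim + 2) (hne : τ₁ ≠ τ₂)
    (h₁ : ρ < τ₁) (h₁' : τ₁ < σ) (h₂ : ρ < τ₂) (h₂' : τ₂ < σ) (h : ρ < τ) (h' : τ < σ) :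
    τ = τ₁ ∨ τ = τ₂ := by
  have hdim : ∀ {π : Δ.Face}, ρ < π → π < σ → π.dim = ρ.dim + 1 := fun h h' => by
    have := dim_lt_dim h
    have := dim_lt_dim h'
    omega
  obtain ⟨z, hz⟩ := ρ.nonempty
  obtain ⟨y, hy, hyρ⟩ := exists_mem_notMem_of_lt h
  obtain ⟨y₁, hy₁, hy₁ρ⟩ := exists_mem_notMem_of_lt h₁
  obtain ⟨y₂, hy₂, hy₂ρ⟩ := exists_mem_notMem_of_lt h₂
  have hy₁₂ : y₁ ∉ τ₂.carrier := fun h =>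
    hne (eq_of_mem_inter h₁.le h₂.le (hdim h₁ h₁') (hdim h₂ h₂') hy₁ h hy₁ρ)
  have hy₂₁ : y₂ ∉ τ₁.carrier := fun h =>
    hne (eq_of_mem_inter h₁.le h₂.le (hdim h₁ h₁') (hdim h₂ h₂') h hy₂ hy₂ρ)
  have hD₁ := sup_span_eq (direction_mono h₁.le) (hdim h₁ h₁')
    (sub_mem_direction hy₁ (h₁.le hz)) (sub_notMem_direction (τ₁.subset_carrier hy₁) hy₁ρ hz)
  have hDσ := sup_span_eq (direction_mono h₁'.le)
    (show σ.dim = τ₁.dim + 1 by have := hdim h₁ h₁'; omega)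
    (sub_mem_direction (h₂'.le hy₂) (h₁'.le (h₁.le hz)))
    (sub_notMem_direction (τ₂.subset_carrier hy₂) hy₂₁ (h₁.le hz))
  have hspan : ∀ v ∈ σ.direction, ∃ r ∈ ρ.direction, ∃ a b : ℝ,
      v = r + a • (y₁ - z) + b • (y₂ - z) := by
    intro v hv
    rw [← hDσ, ← hD₁] at hv
    obtain ⟨u, hu, u', hu', rfl⟩ := Submodule.mem_sup.1 hv
    obtain ⟨r, hr, u'', hu'', rfl⟩ := Submodule.mem_sup.1 hu
    obtain ⟨a, rfl⟩ := Submodule.mem_span_singleton.1 hu''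
    obtain ⟨b, rfl⟩ := Submodule.mem_span_singleton.1 hu'
    exact ⟨r, hr, a, b, rfl⟩
  obtain ⟨k₁, c₁, hkc₁, hk₁⟩ := τ₁.exists_functional
  obtain ⟨k₂, c₂, hkc₂, hk₂⟩ := τ₂.exists_functional
  obtain ⟨k, c, hkc, hk⟩ := τ.exists_functional
  have hzero : ∀ {π : Δ.Face} {l : Dual ℝ V} {a : ℝ},
      (∀ x ∈ Δ.carrier, l x = a ↔ x ∈ π.carrier) → ∀ v ∈ π.direction, l v = 0 := fun hl v hv =>
    eq_zero_on_direction (fun x hx => (hl x (Face.subset_carrier _ hx)).2 hx) hv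
  have hnonneg : ∀ {π : Δ.Face} {l : Dual ℝ V} {a : ℝ}, ρ ≤ π → (∀ x ∈ Δ.carrier, a ≤ l x) →
      (∀ x ∈ Δ.carrier, l x = a ↔ x ∈ π.carrier) → ∀ x ∈ Δ.carrier, 0 ≤ l (x - z) := by
    intro π l a hρ hla hl x hx
    rw [map_sub, (hl z (ρ.subset_carrier hz)).2 (hρ hz)]
    exact sub_nonneg.2 (hla x hx)
  have hyΔ := τ.subset_carrier hy
  -- The functionals exposing `τ₁` and `τ₂` force `a, b ≥ 0`. If one coefficient is zero, `y` lies
  -- in `τ₂` or `τ₁`. If both are positive, the functional exposing `τ` vanishes on all of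
  -- `σ.direction`, which contradicts `τ < σ`.
  obtain ⟨r, hr, a, b, hab⟩ := hspan (y - z) (sub_mem_direction (h'.le hy) (h'.le (h.le hz)))
  have e₁ : k₁ (y - z) = b * k₁ (y₂ - z) := by
    rw [hab, map_add, map_add, map_smul, map_smul, hzero hk₁ r (direction_mono h₁.le hr),
      hzero hk₁ _ (sub_mem_direction hy₁ (h₁.le hz))]
    simp
  have e₂ : k₂ (y - z) = a * k₂ (y₁ - z) := by
    rw [hab, map_add, map_add, map_smul, map_smul, hzero hk₂ r (direction_mono h₂.le hr),
      hzero hk₂ _ (sub_mem_direction hy₂ (h₂.le hz))]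
    simp
  have e : a * k (y₁ - z) + b * k (y₂ - z) = 0 := by
    have := hzero hk _ (sub_mem_direction hy (h.le hz))
    rw [hab, map_add, map_add, map_smul, map_smul, hzero hk r (direction_mono h.le hr)] at this
    simpa using this
  have p₁ := pos_sub_of_notMem hkc₁ hk₁ (τ₂.subset_carrier hy₂) hy₂₁ (h₁.le hz)
  have p₂ := pos_sub_of_notMem hkc₂ hk₂ (τ₁.subset_carrier hy₁) hy₁₂ (h₂.le hz)
  have hb : 0 ≤ b := by
    have := hnonneg h₁.le hkc₁ hk₁ y hyΔ
    rw [e₁] at this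
    exact nonneg_of_mul_nonneg_left this p₁
  have ha : 0 ≤ a := by
    have := hnonneg h₂.le hkc₂ hk₂ y hyΔ
    rw [e₂] at this
    exact nonneg_of_mul_nonneg_left this p₂
  have n₁ := hnonneg h.le hkc hk y₁ (τ₁.subset_carrier hy₁)
  have n₂ := hnonneg h.le hkc hk y₂ (τ₂.subset_carrier hy₂)
  rcases ha.eq_or_lt with ha0 | ha0
  · right
    rw [← ha0, zero_mul, map_sub, (hk₂ z (ρ.subset_carrier hz)).2 (h₂.le hz)] at e₂
    exact eq_of_mem_inter h.le h₂.le (hdim h h') (hdim h₂ h₂') hy ((hk₂ y hyΔ).1 (by linarith)) hyρ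
  rcases hb.eq_or_lt with hb0 | hb0
  · left
    rw [← hb0, zero_mul, map_sub, (hk₁ z (ρ.subset_carrier hz)).2 (h₁.le hz)] at e₁
    exact eq_of_mem_inter h.le h₁.le (hdim h h') (hdim h₁ h₁') hy ((hk₁ y hyΔ).1 (by linarith)) hyρ
  exfalso
  have m₁ := mul_nonneg ha n₁
  have m₂ := mul_nonneg hb n₂
  have q₁ : k (y₁ - z) = 0 :=
    (mul_eq_zero.1 (by linarith : a * k (y₁ - z) = 0)).resolve_left ha0.ne'
  have q₂ : k (y₂ - z) = 0 :=
    (mul_eq_zero.1 (by linarith : b * k (y₂ - z) = 0)).resolve_left hb0.ne'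
  obtain ⟨x, hx, hxτ⟩ := exists_mem_notMem_of_lt h'
  obtain ⟨r', hr', a', b', hab'⟩ :=
    hspan (x - z) (sub_mem_direction hx (h'.le (h.le hz)))
  have := pos_sub_of_notMem hkc hk (σ.subset_carrier hx) hxτ (h.le hz)
  rw [hab', map_add, map_add, map_smul, map_smul, q₁, q₂,
    hzero hk r' (direction_mono h.le hr')] at this
  simp at this

/-- The product of the incidence numbers along `σ > τ > ρ`, computed from vectors `w`, `w'`
pointing from `ρ` into `τ` and from `τ` into `σ`. -/
theorem incidence_mul_incidence (o : Δ.Orientations) {ρ τ σ : Δ.Face} {d : ℕ} (hρτ : ρ ≤ τ)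
    (hτσ : τ ≤ σ) (hρ : ρ.dim = d) (hτ : τ.dim = d + 1) (hσ : σ.dim = d + 2)
    (b : Basis (Fin d) ℝ ρ.direction) {x y z : V} (hz : z ∈ ρ.carrier) (hy : y ∈ τ.carrier)
    (hyρ : y ∉ ρ.carrier) (hx : x ∈ σ.carrier) (hxτ : x ∉ τ.carrier) :
    incidence o σ τ * incidence o τ ρ = SignType.sign
      (orientationForm o σ hσ (Matrix.vecCons (x - z) (Matrix.vecCons (y - z) fun i => b i)) *
        orientationForm o ρ hρ fun i => b i) := by
  obtain ⟨k, c, hkc, hk⟩ := τ.exists_functional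
  obtain ⟨l, e, hle, hl⟩ := ρ.exists_functional
  have hyτ := sub_mem_direction hy (hρτ hz)
  have hly := pos_sub_of_notMem hle hl (τ.subset_carrier hy) hyρ hz
  obtain ⟨b', hb'⟩ := exists_basis_vecCons b (direction_mono hρτ) hτ hyτ
    (notMem_direction hl hly.ne')
  have hb'' : (fun i => (b' i : V)) = Matrix.vecCons (y - z) fun i => b i := funext hb'
  have h1 := orientationForm_ne_zero o τ hτ b'
  rw [incidence_eq_sign o hτσ hτ hσ hkc hk b' (sub_mem_direction hx (hτσ (hρτ hz)))
    (pos_sub_of_notMem hkc hk (σ.subset_carrier hx) hxτ (hρτ hz)),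
    incidence_eq_sign o hρτ hρ hτ hle hl b hyτ hly, hb'']
  rw [hb''] at h1
  have h2 : ∀ s t : SignType, ((s : SignType) : ℤ) * (t : ℤ) = ((s * t : SignType) : ℤ) := by
    decide
  rw [h2, ← sign_mul]
  congr 1
  -- The form of the middle face `τ` occurs squared, so its orientation drops out.
  rw [show ∀ p q r : ℝ, p * q * (q * r) = q ^ 2 * (p * r) from fun p q r => by ring, sign_mul,
    sign_pos (by positivity), one_mul]

theorem sum_boundaryCoeff_mul [IsTopologicalAddGroup V] [ContinuousSMul ℝ V] [T2Space V]
    [Fintype Δ.Face] (o : Δ.Orientations) (σ ρ : Δ.Face) :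
    ∑ τ, boundaryCoeff o σ τ * boundaryCoeff o τ ρ = 0 := by
  classical
  by_cases hd : ρ < σ ∧ σ.dim = ρ.dim + 2
  swap
  · refine Finset.sum_eq_zero fun τ _ => ?_
    by_contra hne
    have h1 := boundaryCoeff_ne_zero (left_ne_zero_of_mul hne)
    have h2 := boundaryCoeff_ne_zero (right_ne_zero_of_mul hne)
    exact hd ⟨h2.1.trans h1.1, by omega⟩
  obtain ⟨hlt, hdim⟩ := hd
  obtain ⟨τ₁, τ₂, hne, h₁, h₁', h₂, h₂'⟩ := exists_pair_between hlt hdim.ge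
  have hτ : ∀ {π : Δ.Face}, ρ < π → π < σ → π.dim = ρ.dim + 1 := fun h h' => by
    have := dim_lt_dim h
    have := dim_lt_dim h'
    omega
  have hsub : ∑ τ ∈ {τ₁, τ₂}, boundaryCoeff o σ τ * boundaryCoeff o τ ρ =
      ∑ τ, boundaryCoeff o σ τ * boundaryCoeff o τ ρ := by
    refine Finset.sum_subset (Finset.subset_univ _) fun τ _ hτ => ?_
    by_contra hne'
    have h1 := boundaryCoeff_ne_zero (left_ne_zero_of_mul hne')
    have h2 := boundaryCoeff_ne_zero (right_ne_zero_of_mul hne')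
    exact hτ (by simpa using eq_or_eq_of_between hdim hne h₁ h₁' h₂ h₂' h2.1 h1.1)
  rw [← hsub, Finset.sum_pair hne]
  have d₁ := hτ h₁ h₁'
  have d₂ := hτ h₂ h₂'
  unfold boundaryCoeff
  rw [if_pos ⟨h₁', by omega⟩, if_pos ⟨h₁, d₁⟩, if_pos ⟨h₂', by omega⟩, if_pos ⟨h₂, d₂⟩]
  obtain ⟨z, hz⟩ := ρ.nonempty
  obtain ⟨y₁, hy₁, hy₁ρ⟩ := exists_mem_notMem_of_lt h₁
  obtain ⟨y₂, hy₂, hy₂ρ⟩ := exists_mem_notMem_of_lt h₂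
  let b : Basis (Fin ρ.dim) ℝ ρ.direction := Module.finBasis ℝ ρ.direction
  -- Crosswise choice: `y₂` serves as the point of `σ` outside `τ₁`, and `y₁` as the point outside
  -- `τ₂`. Both products then involve the same two vectors, in opposite orders.
  rw [incidence_mul_incidence o h₁.le h₁'.le rfl d₁ hdim b hz hy₁ hy₁ρ (h₂'.le hy₂)
      fun h => hne (eq_of_mem_inter h₁.le h₂.le d₁ d₂ h hy₂ hy₂ρ),
    incidence_mul_incidence o h₂.le h₂'.le rfl d₂ hdim b hz hy₂ hy₂ρ (h₁'.le hy₁)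
      fun h => hne (eq_of_mem_inter h₁.le h₂.le d₁ d₂ hy₁ h hy₁ρ)]
  have hswap : orientationForm o σ hdim
      (Matrix.vecCons (y₁ - z) (Matrix.vecCons (y₂ - z) fun i => (b i : V))) =
      -orientationForm o σ hdim
      (Matrix.vecCons (y₂ - z) (Matrix.vecCons (y₁ - z) fun i => (b i : V))) := by
    rw [← AlternatingMap.map_swap _ _ (show (0 : Fin (ρ.dim + 2)) ≠ 1 by simp)]
    congr 1
    funext i
    refine Fin.cases ?_ (fun i => Fin.cases ?_ (fun i => ?_) i) i
    · simp
    · simp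
    · rw [Function.comp_apply, Equiv.swap_apply_of_ne_of_ne]
      · rfl
      · exact Fin.succ_ne_zero _
      · exact fun h => Fin.succ_ne_zero i (Fin.succ_injective _ h)
  rw [hswap, neg_mul, Left.sign_neg]
  exact (by decide : ∀ s : SignType, (s : ℤ) + ((-s : SignType) : ℤ) = 0) _

end Polyhedron
end CechPoly

/-! ### From the combinatorics of faces back to sheaves. -/

namespace CechPoly

theorem pointEval_eq_of_isPreconnected {X : TopCat.{u}} {S : Set X} {U : Opens X}
    (h : IsPreconnected (S ∩ U)) {x y : X} (hxS : x ∈ S) (hxU : x ∈ U) (hyS : y ∈ S) (hyU : y ∈ U)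
    (s : Sections (constOn S) U) : pointEval S U x hxS hxU s = pointEval S U y hyS hyU s := by
  have hind : Topology.IsInducing
      (fun a : (Opens.map (incl S)).obj U => ((a : TopCat.of S) : S).1) :=
    Topology.IsInducing.subtypeVal.comp Topology.IsInducing.subtypeVal
  have hpre : IsPreconnected (Set.univ : Set ((Opens.map (incl S)).obj U)) := by
    rw [← hind.isPreconnected_image]
    convert h using 1
    ext a
    constructor
    · rintro ⟨b, -, rfl⟩
      exact ⟨b.1.2, b.2⟩
    · rintro ⟨haS, haU⟩
      exact ⟨⟨⟨a, haS⟩, haU⟩, trivial, rfl⟩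
  exact (LocallyConstant.isLocallyConstant
    (show LocallyConstant ((Opens.map (incl S)).obj U) ℤ from s)).apply_eq_of_isPreconnected hpre
      trivial trivial

/-- The constant section of `ℤ_S` with a given value. -/
def constSection {X : TopCat.{u}} (S : Set X) (U : Opens X) (m : ℤ) : Sections (constOn S) U :=
  (LocallyConstant.const ((Opens.map (incl S)).obj U) m :)

theorem pointEval_constSection {X : TopCat.{u}} (S : Set X) (U : Opens X) (m : ℤ) (x : X)
    (hS : x ∈ S) (hU : x ∈ U) : pointEval S U x hS hU (constSection S U m) = m := rfl

namespace Polyhedron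

open Module Face

variable {V : Type u} [AddCommGroup V] [Module ℝ V] [TopologicalSpace V] {Δ : Polyhedron V}

/-- The polyhedron as a face of itself. -/
def topFace (Δ : Polyhedron V) (hne : Δ.carrier.Nonempty) : Δ.Face :=
  ⟨Δ.carrier, IsExposed.refl _, hne⟩

theorem le_topFace (hne : Δ.carrier.Nonempty) (σ : Δ.Face) : σ ≤ Δ.topFace hne := σ.subset_carrier

theorem codim_topFace (hne : Δ.carrier.Nonempty)
    (hdim : finrank ℝ (vectorSpan ℝ Δ.carrier) = finrank ℝ V) : (Δ.topFace hne).codim = 0 := by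
  unfold codim dim
  exact Nat.sub_eq_zero_of_le hdim.ge

section

variable [FiniteDimensional ℝ V]

theorem codim_eq_add_one {σ τ : Δ.Face} (h : σ.dim = τ.dim + 1) : τ.codim = σ.codim + 1 := by
  have : σ.dim ≤ finrank ℝ V := Submodule.finrank_le _
  unfold codim
  omega

theorem dim_eq_add_one {σ τ : Δ.Face} (h : τ.codim = σ.codim + 1) : σ.dim = τ.dim + 1 := by
  have : σ.dim ≤ finrank ℝ V := Submodule.finrank_le _
  unfold codim at h
  omega

end

open Classical in
/-- The cellular chain given by the values at a point `x` of the components of a section of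
`C^p`. -/
def chainAt {p : ℕ} (U : Opens Δ.space) (x : Δ.space) (hU : x ∈ U) (s : Sections (Δ.cechX p) U)
    (σ : Δ.Face) : ℤ :=
  if h : σ.codim = p ∧ x ∈ σ.toSet then cechEval U ⟨σ, h.1⟩ x h.2 hU s else 0

theorem chainAt_eq {p : ℕ} (U : Opens Δ.space) (x : Δ.space) (hU : x ∈ U)
    (s : Sections (Δ.cechX p) U) (σ : Δ.FacesOfCodim p) (hx : x ∈ σ.1.toSet) :
    chainAt U x hU s σ.1 = cechEval U σ x hx hU s := dif_pos ⟨σ.2, hx⟩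

theorem eq_zero_of_cechAug_eq_zero (hne : Δ.carrier.Nonempty)
    (hdim : finrank ℝ (vectorSpan ℝ Δ.carrier) = finrank ℝ V) (U : Opens Δ.space)
    (s : Sections (extByZero Δ.interiorSet) U) (hs : onSections _ _ U Δ.cechAug s = 0) :
    s = 0 := by
  refine Subtype.ext (LocallyConstant.ext fun a => ?_)
  have h1 := cechEval_cechAug U ⟨Δ.topFace hne, codim_topFace hne hdim⟩ a.1.1 a.1.1.2 a.2 s
  rw [hs, map_zero] at h1
  exact (h1.trans (dif_pos a.1.2)).symm

variable [FiniteDimensional ℝ V]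

/-- For codimensions `p` and `p + 1`, inclusion of faces is automatically strict with dimension drop
one, so the sheaf differential has exactly the entries of `boundaryCoeff`. -/
theorem cechEval_cechD_eq_sum [Fintype Δ.Face] (o : Δ.Orientations) {p : ℕ} (U : Opens Δ.space)
    (τ : Δ.FacesOfCodim (p + 1)) (x : Δ.space) (hx : x ∈ τ.1.toSet) (hU : x ∈ U)
    (s : Sections (Δ.cechX p) U) :
    cechEval U τ x hx hU (onSections _ _ U (cechD o p) s) =
      ∑ σ, chainAt U x hU s σ * boundaryCoeff o σ τ.1 := by
  classical
  rw [cechEval_cechD]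
  have h1 : ∑ σ ∈ Finset.univ.filter (fun σ : Δ.Face => σ.codim = p),
      chainAt U x hU s σ * boundaryCoeff o σ τ.1 =
      ∑ σ, chainAt U x hU s σ * boundaryCoeff o σ τ.1 := by
    refine Finset.sum_subset (Finset.subset_univ _) fun σ _ hσ => ?_
    rw [chainAt, dif_neg (fun h => hσ (by simp [h.1])), zero_mul]
  rw [← h1, Finset.sum_subtype (p := fun σ : Δ.Face => σ.codim = p) _ (by simp)]
  refine Finset.sum_congr rfl fun σ _ => ?_
  have hcoeff : boundaryCoeff o σ.1 τ.1 = cechCoeff o σ.1 τ.1 := by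
    have hd : σ.1.dim = τ.1.dim + 1 := dim_eq_add_one (by rw [σ.2, τ.2])
    unfold boundaryCoeff cechCoeff
    congr 1
    refine propext ⟨fun h => h.1.le, fun h => ⟨lt_of_le_of_ne h fun he => ?_, hd⟩⟩
    rw [he] at hd
    omega
  split_ifs with h
  · rw [chainAt_eq U x hU s σ h, hcoeff, mul_comm]
  · rw [chainAt, dif_neg fun h' => h h'.2, zero_mul]

/-- The chain of a section annihilated by the differential is a cycle. -/
theorem sum_chainAt_mul_eq_zero [Fintype Δ.Face] (o : Δ.Orientations) {p : ℕ}
    {U : Opens Δ.space} {x : Δ.space} (hU : x ∈ U) {s : Sections (Δ.cechX p) U}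
    (hs : onSections _ _ U (cechD o p) s = 0) {τ : Δ.Face} (hτ : x ∈ τ.toSet) :
    ∑ σ, chainAt U x hU s σ * boundaryCoeff o σ τ = 0 := by
  by_cases hc : τ.codim = p + 1
  · rw [← cechEval_cechD_eq_sum o U ⟨τ, hc⟩ x hτ hU s, hs, map_zero]
  · refine Finset.sum_eq_zero fun σ _ => ?_
    by_contra hne
    have h1 := (boundaryCoeff_ne_zero (right_ne_zero_of_mul hne)).2
    have h2 := codim_eq_add_one h1
    have h3 : σ.codim = p := by
      by_contra h3
      exact left_ne_zero_of_mul hne (dif_neg fun h => h3 h.1)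
    omega

variable [IsTopologicalAddGroup V] [ContinuousSMul ℝ V] [T2Space V]

theorem cechD_comp_cechD (o : Δ.Orientations) (p : ℕ) : cechD o p ≫ cechD o (p + 1) = 0 := by
  have := Fintype.ofFinite Δ.Face
  refine hom_ext_onSections fun U s => cechEval_ext fun ρ x hx hU => ?_
  rw [onSections_comp, cechEval_cechD_eq_sum]
  have h1 : ∀ τ, chainAt U x hU (onSections _ _ U (cechD o p) s) τ * boundaryCoeff o τ ρ.1 =
      ∑ σ, chainAt U x hU s σ * (boundaryCoeff o σ τ * boundaryCoeff o τ ρ.1) := by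
    intro τ
    by_cases h0 : boundaryCoeff o τ ρ.1 = 0
    · simp [h0]
    obtain ⟨hlt, hd⟩ := boundaryCoeff_ne_zero h0
    have hτ : τ.codim = p + 1 := by
      have := codim_eq_add_one hd
      have := ρ.2
      omega
    have hxτ : x ∈ τ.toSet := hlt.le hx
    rw [chainAt_eq U x hU _ ⟨τ, hτ⟩ hxτ, cechEval_cechD_eq_sum, Finset.sum_mul]
    exact Finset.sum_congr rfl fun _ _ => mul_assoc _ _ _
  rw [Finset.sum_congr rfl fun τ _ => h1 τ, Finset.sum_comm]
  simp only [← Finset.mul_sum, sum_boundaryCoeff_mul, mul_zero, Finset.sum_const_zero]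
  simp

/-- Every point of a polyhedron is contained in a least face. -/
theorem exists_least_face (x : V) (hx : x ∈ Δ.carrier) :
    ∃ G : Δ.Face, x ∈ G.carrier ∧ (∀ σ : Δ.Face, x ∈ σ.carrier → G ≤ σ) ∧
      (finrank ℝ (vectorSpan ℝ Δ.carrier) = finrank ℝ V → Δ.carrier ⊆ G.carrier →
        x ∈ interior Δ.carrier) := by
  classical
  obtain ⟨I, hI⟩ := Δ.exists_finset
  change Δ.carrier = solutionSet I at hI
  obtain ⟨h, c, hc, ht⟩ := exists_functional_of_tight I (I.filter fun p => p.1 x = p.2)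
    (Finset.filter_subset _ _)
  rw [← hI] at hc ht
  have hxc : h x = c := (ht x hx).2 fun p hp => (Finset.mem_filter.1 hp).2
  obtain ⟨G, hG⟩ : ∃ G : Δ.Face, ∀ y, y ∈ G.carrier ↔ y ∈ Δ.carrier ∧ h y = c :=
    (Δ.topFace ⟨x, hx⟩).exists_of_functional h c hc ⟨x, hx, hxc⟩
  refine ⟨G, (hG x).2 ⟨hx, hxc⟩, fun σ hxσ y hy => ?_, fun hdim hsub => ?_⟩
  · obtain ⟨hyΔ, hyc⟩ := (hG y).1 hy
    obtain ⟨k, a, hka, hk⟩ := σ.exists_functional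
    refine (hk y hyΔ).1 ?_
    rw [hI] at hka
    refine mem_face_of_tight hka ⟨x, hI ▸ hx, (hk x hx).2 hxσ⟩ (hI ▸ hyΔ) fun p hp hp' => ?_
    refine (ht y hyΔ).1 hyc p (Finset.mem_filter.2 ⟨hp, ?_⟩)
    exact hp' x ⟨hI ▸ hx, (hk x hx).2 hxσ⟩
  · have hspan : vectorSpan ℝ Δ.carrier = ⊤ := Submodule.eq_top_of_finrank_eq hdim
    -- If the least face is all of `Δ`, an inequality tight at `x` is constant on a set spanning
    -- `V`, so it reads `0 ≤ 0`. The remaining ones are strict at `x` and define a neighbourhood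
    -- inside `Δ`.
    have htriv : ∀ p ∈ I, p.1 x = p.2 → p.1 = 0 := fun p hp hpx => by
      refine LinearMap.ext fun v => ?_
      refine eq_zero_on_direction (σ := Δ.topFace ⟨x, hx⟩) (c := p.2) (fun y hy => ?_)
        (show v ∈ vectorSpan ℝ Δ.carrier by rw [hspan]; trivial)
      exact (ht y hy).1 ((hG y).1 (hsub hy)).2 p (Finset.mem_filter.2 ⟨hp, hpx⟩)
    rw [mem_interior]
    refine ⟨⋂ p ∈ I.filter fun p => p.1 x ≠ p.2, {y | p.1 y < p.2}, fun y hy => ?_, ?_, ?_⟩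
    · rw [hI]
      intro p hp
      by_cases hpx : p.1 x = p.2
      · rw [← hpx, htriv p hp hpx]
        simp
      · exact le_of_lt (Set.mem_iInter₂.1 hy p (Finset.mem_filter.2 ⟨hp, hpx⟩))
    · exact isOpen_biInter_finset fun p _ =>
        isOpen_lt p.1.continuous_of_finiteDimensional continuous_const
    · refine Set.mem_iInter₂.2 fun p hp => ?_
      obtain ⟨hp, hpx⟩ := Finset.mem_filter.1 hp
      exact lt_of_le_of_ne ((hI ▸ hx : x ∈ solutionSet I) p hp) hpx

-- From an interior point one can move slightly away from any `y` in `Δ`; a functional with its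
-- minimum at `x` then has the same value at `y`.
omit [FiniteDimensional ℝ V] [T2Space V] in
theorem subset_of_mem_interior {x : V} (hx : x ∈ interior Δ.carrier) (σ : Δ.Face)
    (hxσ : x ∈ σ.carrier) : Δ.carrier ⊆ σ.carrier := by
  intro y hy
  obtain ⟨k, c, hkc, hk⟩ := σ.exists_functional
  have hcont : Filter.Tendsto (fun t : ℝ => x + t • (x - y)) (nhds 0) (nhds (x + (0 : ℝ) • (x - y))) :=
    Continuous.tendsto (by fun_prop) 0
  rw [zero_smul, add_zero] at hcont
  obtain ⟨t, ht, ht0⟩ := (((hcont.eventually (mem_interior_iff_mem_nhds.1 hx)).filter_mono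
    nhdsWithin_le_nhds).and (self_mem_nhdsWithin (s := Set.Ioi (0 : ℝ)))).exists
  have h1 := hkc _ ht
  have h2 := (hk x (σ.subset_carrier hxσ)).2 hxσ
  simp only [map_add, map_smul, map_sub, smul_eq_mul, h2] at h1
  have h3 := nonneg_of_mul_nonneg_right (by linarith : 0 ≤ t * (c - k y)) ht0
  exact (hk y hy).1 (by linarith [hkc y hy])

omit [FiniteDimensional ℝ V] [T2Space V] in
theorem codim_eq_zero_of_mem_interior
    (hdim : finrank ℝ (vectorSpan ℝ Δ.carrier) = finrank ℝ V) {x : V}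
    (hx : x ∈ interior Δ.carrier) (σ : Δ.Face) (hxσ : x ∈ σ.carrier) : σ.codim = 0 := by
  have hne : Δ.carrier.Nonempty := ⟨x, interior_subset hx⟩
  have : σ = Δ.topFace hne := (le_topFace hne σ).antisymm (subset_of_mem_interior hx σ hxσ)
  rw [this]
  exact codim_topFace hne hdim

/-- The cellular complex of the faces containing a boundary point is acyclic. -/
theorem isAcyclicOn_faces_of_notMem_interior [Fintype Δ.Face] (o : Δ.Orientations)
    (hdim : finrank ℝ (vectorSpan ℝ Δ.carrier) = finrank ℝ V) {x : V} (hx : x ∈ Δ.carrier)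
    (hxi : x ∉ interior Δ.carrier) :
    IsAcyclicOn (boundaryCoeff o) {σ : Δ.Face | x ∈ σ.carrier} := by
  obtain ⟨G, hxG, hG, hGi⟩ := exists_least_face x hx
  have : {σ : Δ.Face | x ∈ σ.carrier} = Set.Icc G (Δ.topFace ⟨x, hx⟩) :=
    Set.ext fun σ => ⟨fun h => ⟨hG σ h, le_topFace _ σ⟩, fun h => h.1 hxG⟩
  rw [this]
  refine isAcyclicOn_Icc (fun σ τ h => (boundaryCoeff_ne_zero h).1)
    (fun σ τ h h' => boundaryCoeff_eq_one_or h h') (sum_boundaryCoeff_mul o)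
    (lt_of_le_of_ne (le_topFace _ G) fun h => hxi (hGi hdim ?_))
  rw [h]
  exact subset_rfl

theorem Face.isClosed (σ : Δ.Face) : IsClosed σ.carrier := by
  obtain ⟨I, hI⟩ := σ.exists_solutionSet
  have : solutionSet I = ⋂ p ∈ I, {x | p.1 x ≤ p.2} := by
    ext x; simp [solutionSet]
  rw [hI, this]
  exact isClosed_biInter fun p _ =>
    isClosed_le p.1.continuous_of_finiteDimensional continuous_const

/-- Every point has arbitrarily small convex neighbourhoods which meet only the faces through this
point. -/
theorem exists_convex_neighbourhood (Δ : Polyhedron V) (x : V) (U : Set V) (hU : IsOpen U)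
    (hx : x ∈ U) :
    ∃ B : Set V, IsOpen B ∧ Convex ℝ B ∧ x ∈ B ∧ B ⊆ U ∧
      ∀ σ : Δ.Face, ∀ y ∈ B, y ∈ σ.carrier → x ∈ σ.carrier := by
  -- Remove the finitely many closed faces that miss `x`, then shrink to a Euclidean ball.
  have hO : IsOpen (U ∩ ⋂ σ : {σ : Δ.Face // x ∉ σ.carrier}, (σ.1.carrier)ᶜ) :=
    hU.inter (isOpen_iInter_of_finite fun σ => σ.1.isClosed.isOpen_compl)
  obtain ⟨r, hr, hball⟩ := Euclidean.nhds_basis_ball.mem_iff.1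
    (hO.mem_nhds ⟨hx, Set.mem_iInter.2 fun σ => σ.2⟩)
  refine ⟨Euclidean.ball x r, Euclidean.isOpen_ball, ?_, Euclidean.mem_ball_self hr,
    fun y hy => (hball hy).1, fun σ y hy hyσ => ?_⟩
  · rw [Euclidean.ball_eq_preimage]
    exact (convex_ball _ _).linear_preimage toEuclidean.toLinearMap
  · by_contra hxσ
    exact Set.mem_iInter.1 (hball hy).2 ⟨σ, hxσ⟩ hyσ

omit [FiniteDimensional ℝ V] [T2Space V] in
theorem isPreconnected_toSet_inter (σ : Δ.Face) {B : Set V} (hB : Convex ℝ B) :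
    IsPreconnected (σ.toSet ∩ (Subtype.val ⁻¹' B : Set Δ.carrier)) := by
  have hind : Topology.IsInducing (Subtype.val : Δ.carrier → V) := Topology.IsInducing.subtypeVal
  refine hind.isPreconnected_image.1 ?_
  have : Subtype.val '' (σ.toSet ∩ (Subtype.val ⁻¹' B : Set Δ.carrier)) = σ.carrier ∩ B := by
    ext y
    constructor
    · rintro ⟨z, hz, rfl⟩
      exact hz
    · exact fun hy => ⟨⟨y, σ.subset_carrier hy.1⟩, hy, rfl⟩
  rw [this]
  exact (σ.convex.inter hB).isPreconnected

/-- Every point of a polyhedron has arbitrarily small neighbourhoods which meet only the faces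
through this point, and meet them in connected sets. -/
theorem exists_good_neighbourhood (x : Δ.space) (U : Opens Δ.space) (hU : x ∈ U) :
    ∃ W : Opens Δ.space, x ∈ W ∧ W ≤ U ∧
      (∀ σ : Δ.Face, IsPreconnected (σ.toSet ∩ W)) ∧
      ∀ (σ : Δ.Face), ∀ y ∈ W, y ∈ σ.toSet → x ∈ σ.toSet := by
  obtain ⟨U', hU', hUU'⟩ := isOpen_induced_iff.1 U.isOpen
  have hUmem : ∀ y : Δ.space, y.1 ∈ U' ↔ y ∈ U := fun y => Set.ext_iff.1 hUU' y
  obtain ⟨B, hB, hBconv, hxB, hBU, hBσ⟩ :=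
    exists_convex_neighbourhood Δ x.1 U' hU' ((hUmem x).2 hU)
  let W : Opens Δ.space := ⟨Subtype.val ⁻¹' B, hB.preimage continuous_subtype_val⟩
  exact ⟨W, hxB, fun y hy => (hUmem y).1 (hBU hy), fun σ => isPreconnected_toSet_inter σ hBconv,
    fun σ y hy hyσ => hBσ σ y.1 hy hyσ⟩

omit [FiniteDimensional ℝ V] [IsTopologicalAddGroup V] [ContinuousSMul ℝ V] [T2Space V] in
theorem cechEval_eq_of_isPreconnected {p : ℕ} {U : Opens Δ.space} {σ : Δ.FacesOfCodim p}
    (h : IsPreconnected (σ.1.toSet ∩ U)) {x y : Δ.space} (hx : x ∈ σ.1.toSet) (hxU : x ∈ U)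
    (hy : y ∈ σ.1.toSet) (hyU : y ∈ U) (s : Sections (Δ.cechX p) U) :
    cechEval U σ x hx hxU s = cechEval U σ y hy hyU s :=
  pointEval_eq_of_isPreconnected h _ _ _ _ _

theorem exists_cechD_eq (o : Δ.Orientations)
    (hdim : finrank ℝ (vectorSpan ℝ Δ.carrier) = finrank ℝ V) {p : ℕ} (x : Δ.space)
    (U : Opens Δ.space) (hU : x ∈ U) (s : Sections (Δ.cechX (p + 1)) U)
    (hs : onSections _ _ U (cechD o (p + 1)) s = 0) :
    ∃ (W : Opens Δ.space) (_ : x ∈ W) (hWU : W ≤ U) (t : Sections (Δ.cechX p) W),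
      onSections _ _ W (cechD o p) t = Sections.res hWU s := by
  have := Fintype.ofFinite Δ.Face
  obtain ⟨W, hxW, hWU, hconn, hface⟩ := exists_good_neighbourhood x U hU
  refine ⟨W, hxW, hWU, ?_⟩
  by_cases hxi : x.1 ∈ interior Δ.carrier
  -- Near an interior point there are no faces of positive codimension, so the group of degree `p +
  -- 1` vanishes.
  · refine ⟨0, cechEval_ext fun σ y hy hyW => ?_⟩
    have h0 := codim_eq_zero_of_mem_interior hdim hxi σ.1 (hface σ.1 y hyW hy)
    have := σ.2
    omega
  obtain ⟨y, hyx, hy⟩ := isAcyclicOn_faces_of_notMem_interior o hdim x.2 hxi (chainAt U x hU s)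
    (fun σ hσ => dif_neg fun h => hσ h.2) fun τ hτ => sum_chainAt_mul_eq_zero o hU hs hτ
  -- The primitive `y` may have components in every codimension; only those of codimension `p`
  -- contribute to the boundary on faces of codimension `p + 1`, so the rest is discarded.
  obtain ⟨t, ht⟩ := exists_cechEval_eq W fun σ : Δ.FacesOfCodim p =>
    constSection σ.1.toSet W (y σ.1)
  refine ⟨t, cechEval_ext fun τ a ha haW => ?_⟩
  have hxτ := hface τ.1 a haW ha
  rw [cechEval_eq_of_isPreconnected (hconn τ.1) ha haW hxτ hxW,
    cechEval_eq_of_isPreconnected (hconn τ.1) ha haW hxτ hxW, cechEval_map,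
    cechEval_cechD_eq_sum, ← chainAt_eq U x hU s τ hxτ, ← hy τ.1 hxτ]
  refine Finset.sum_congr rfl fun σ _ => ?_
  by_cases h0 : boundaryCoeff o σ τ.1 = 0
  · rw [h0, mul_zero, mul_zero]
  have hσ : σ.codim = p := by
    have := codim_eq_add_one (boundaryCoeff_ne_zero h0).2
    have := τ.2
    omega
  congr 1
  have hxσ : x ∈ σ.toSet := (boundaryCoeff_ne_zero h0).1.le hxτ
  rw [chainAt_eq W x hxW t ⟨σ, hσ⟩ hxσ, ht, pointEval_constSection]

theorem exists_cechAug_eq (o : Δ.Orientations)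
    (hdim : finrank ℝ (vectorSpan ℝ Δ.carrier) = finrank ℝ V) (x : Δ.space)
    (U : Opens Δ.space) (hU : x ∈ U) (s : Sections (Δ.cechX 0) U)
    (hs : onSections _ _ U (cechD o 0) s = 0) :
    ∃ (W : Opens Δ.space) (_ : x ∈ W) (hWU : W ≤ U) (t : Sections (extByZero Δ.interiorSet) W),
      onSections _ _ W Δ.cechAug t = Sections.res hWU s := by
  have := Fintype.ofFinite Δ.Face
  by_cases hxi : x.1 ∈ interior Δ.carrier
  · obtain ⟨W, hxW, hWU, hconn, hface⟩ := exists_good_neighbourhood x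
      (U ⊓ ⟨Δ.interiorSet, Δ.isOpen_interiorSet⟩) ⟨hU, hxi⟩
    refine ⟨W, hxW, hWU.trans inf_le_left, ?_⟩
    let m := chainAt U x hU s (Δ.topFace ⟨x.1, x.2⟩)
    let t : Sections (extByZero Δ.interiorSet) W :=
      -- `W` lies in the interior, so the support condition on a section of the extension by zero is
      -- vacuous.
      (⟨LocallyConstant.const _ m, (isClosed_supp_iff _ _ _).2 fun y hy _ => (hWU hy).2⟩ :
        shriekSections Δ.interiorSet W)
    refine ⟨t, cechEval_ext fun σ a ha haW => ?_⟩
    have hxσ := hface σ.1 a haW ha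
    rw [cechEval_cechAug, cechEval_eq_of_isPreconnected (hconn σ.1) ha haW hxσ hxW, cechEval_map,
      ← chainAt_eq U x hU s σ hxσ]
    have hσ : σ.1 = Δ.topFace ⟨x.1, x.2⟩ :=
      (le_topFace _ _).antisymm (subset_of_mem_interior hxi σ.1 hxσ)
    rw [hσ]
    exact dif_pos (hWU haW).2
  · obtain ⟨W, hxW, hWU, hconn, hface⟩ := exists_good_neighbourhood x U hU
    refine ⟨W, hxW, hWU, 0, cechEval_ext fun σ a ha haW => ?_⟩
    have hxσ := hface σ.1 a haW ha
    obtain ⟨y, hyx, hy⟩ := isAcyclicOn_faces_of_notMem_interior o hdim x.2 hxi (chainAt U x hU s)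
      (fun σ hσ => dif_neg fun h => hσ h.2) fun τ hτ => sum_chainAt_mul_eq_zero o hU hs hτ
    rw [map_zero, map_zero, cechEval_eq_of_isPreconnected (hconn σ.1) ha haW hxσ hxW, cechEval_map,
      ← chainAt_eq U x hU s σ hxσ, ← hy σ.1 hxσ]
    -- A boundary has no component on faces of codimension 0, as these are facets of no face; so a
    -- cycle of codimension 0 at a boundary point is zero.
    refine (Finset.sum_eq_zero fun τ _ => ?_).symm
    by_contra hne
    have h1 := codim_eq_add_one (boundaryCoeff_ne_zero (right_ne_zero_of_mul hne)).2
    have := σ.2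
    omega

-- A face of codimension 1 contains no interior point, and extensions by zero vanish off the
-- interior.
omit [T2Space V] in
theorem cechAug_comp_cechD (o : Δ.Orientations)
    (hdim : finrank ℝ (vectorSpan ℝ Δ.carrier) = finrank ℝ V) : Δ.cechAug ≫ cechD o 0 = 0 := by
  have := Fintype.ofFinite Δ.Face
  refine hom_ext_onSections fun U s => cechEval_ext fun τ x hx hU => ?_
  rw [onSections_comp, cechEval_cechD_eq_sum]
  refine (Finset.sum_eq_zero fun σ _ => ?_).trans (by simp)
  have hxi : x ∉ Δ.interiorSet := fun hxi => by
    have h0 := codim_eq_zero_of_mem_interior hdim hxi τ.1 hx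
    have := τ.2
    omega
  unfold chainAt
  split_ifs with h
  · rw [cechEval_cechAug, show zeroExt Δ.isOpen_interiorSet U s ⟨x, hU⟩ = 0 from dif_neg hxi,
      zero_mul]
  · rw [zero_mul]

end Polyhedron
end CechPoly
end

theorem proposition2p3 {V : Type u} [AddCommGroup V] [Module ℝ V] [FiniteDimensional ℝ V]
    [TopologicalSpace V] [IsTopologicalAddGroup V] [ContinuousSMul ℝ V] [T2Space V]
    (n : ℕ) (hV : Module.finrank ℝ V = n)
    (Δ : CechPoly.Polyhedron V) (hne : Δ.carrier.Nonempty)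
    (hdim : Module.finrank ℝ (vectorSpan ℝ Δ.carrier) = n)
    (o : Δ.Orientations) :
    ∃ (hd : ∀ p, CechPoly.Polyhedron.cechD o p ≫ CechPoly.Polyhedron.cechD o (p + 1) = 0)
      (ha : Δ.cechAug ≫ CechPoly.Polyhedron.cechD o 0 = 0),
      QuasiIso (CechPoly.Polyhedron.cechMap o hd ha) := by
  have hdim' := hdim.trans hV.symm
  have hd := CechPoly.Polyhedron.cechD_comp_cechD o
  have ha := CechPoly.Polyhedron.cechAug_comp_cechD o hdim'
  refine ⟨hd, ha, ?_⟩
  have hK : ∀ p, (CechPoly.Polyhedron.cechComplex o hd).d p (p + 1) =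
      CechPoly.Polyhedron.cechD o p := fun p => CochainComplex.of_d _ _ p
  have h0 : Δ.cechAug ≫ (CechPoly.Polyhedron.cechComplex o hd).d 0 1 = 0 :=
    (congrArg (fun f => Δ.cechAug ≫ f) (hK 0)).trans ha
  have hm : Mono Δ.cechAug := TopCat.Sheaf.mono_of_injective _ fun U s hs =>
    CechPoly.Polyhedron.eq_zero_of_cechAug_eq_zero hne hdim' U s hs
  refine quasiIso_fromSingle₀ (C := Δ.space.Sheaf AddCommGrpCat.{u}) (CechPoly.Polyhedron.cechComplex o hd)
    (CechPoly.extByZero Δ.interiorSet) Δ.cechAug h0 hm ?_ fun p => ?_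
  · refine TopCat.Sheaf.exact_of_locally_exact _ fun x U hU s hs => ?_
    simp only [hK] at hs
    exact CechPoly.Polyhedron.exists_cechAug_eq o hdim' x U hU s hs
  · rw [HomologicalComplex.exactAt_iff' _ p (p + 1) (p + 1 + 1) (by simp) (by simp)]
    refine TopCat.Sheaf.exact_of_locally_exact _ fun x U hU s hs => ?_
    simp only [HomologicalComplex.shortComplexFunctor'_obj_g,
      HomologicalComplex.shortComplexFunctor'_obj_f, hK] at hs ⊢
    exact CechPoly.Polyhedron.exists_cechD_eq o hdim' x U hU s hs
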